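/- **Theorem (Noisy Feedback).** Let $P_1,P_2\ge 0$, $N>0$, and let $K_W$ be a real positive semidefinite $2\times 2$ matrix. Logarithms are natural. *Channel and capacity region.* At time $t$ the channel with inputs $x_{1,t},x_{2,t}\in\mathbb R$ has output $Y_t=x_{1,t}+x_{2,t}+Z_t$, and Transmitter $\nu\in\{1,2\}$ receives the feedback output $V_{\nu,t}=Y_t+W_{\nu,t}$. Here $\{Z_t\}$ is IID centred Gaussian of variance $N$, $\{(W_{1,t},W_{2,t})\}$ is IID centred bivariate Gaussian with covariance matrix $K_W$, and the messages $M_1,M_2$ (independent, uniform on finite nonempty sets $\mathcal M_1,\mathcal M_2$), $\{Z_t\}$ and $\{(W_{1,t},W_{2,t})\}$ are independent. A blocklength-$n$ powers-$(P_1,P_2)$ feedback code consists of (measurable) encoders $X_{\nu,t}=\varphi_{\nu,t}(M_\nu,V_{\nu,1},\dots,V_{\nu,t-1})$, $1\le t\le n$, with $\frac1n\sum_{t=1}^n \mathbb E[X_{\nu,t}^2]\le P_\nu$ for $\nu=1,2$, and a (measurable) decoder $\phi:\mathbb R^n\to\mathcal M_1\times\mathcal M_2$; its rates are $\frac1n\log|\mathcal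 M_1|$ and $\frac1n\log|\mathcal M_2|$. A pair $(R_1,R_2)$ with $R_1,R_2\ge 0$ is achievable if for every $\delta>0$ there are, for all sufficiently large $n$, blocklength-$n$ powers-$(P_1,P_2)$ feedback codes of rates exceeding $R_1-\delta$ and $R_2-\delta$ whose error probabilities $\Pr[\phi(Y_1,\dots,Y_n)\ne(M_1,M_2)]$ tend to $0$ as $n\to\infty$. The capacity region $\mathcal C_{\mathrm{NoisyFB}}(P_1,P_2,N,K_W)$ is the set of achievable pairs. *The region $\mathcal R$.* For a positive integer $\eta$, vectors $a_1,a_2\in\mathbb R^\eta$ and strictly lower-triangular $\eta\times\eta$ matrices $B_1,B_2$, put $$A=\begin{pmatrix}a_1&a_2\end{pmatrix},\quad A_d=\begin{pmatrix}a_1&0\\0&a_2\end{pmatrix},\quad B=\begin{pmatrix}B_1&B_2\end{pmatrix},\quad B_t=\begin{pmatrix}B_1\\B_2\end{pmatrix},\quad B_d=\begin{pmatrix}B_1&0\\0&B_2\end{pmatrix},\quad \bar B=\begin{pmatrix}B_1&B_1\\B_2&B_2\end{pmatrix},$$ $\Sigma=N I_\eta+B(K_W\otimes I_\eta)B^{\mathsf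 T}$ and $$Q=(I_{2\eta}-\bar B)^{-1}\bigl(A_dA_d^{\mathsf T}+N B_tB_t^{\mathsf T}+B_d(K_W\otimes I_\eta)B_d^{\mathsf T}\bigr)(I_{2\eta}-\bar B)^{-\mathsf T}.$$ For a matrix $C$ with $\eta$ columns and $CC^{\mathsf T}$ nonsingular, let $\mathcal L(C)$ be the set of pairs $R_1,R_2\ge0$ with $$R_1\le\tfrac1{2\eta}\log\tfrac{|C(a_1a_1^{\mathsf T}+\Sigma)C^{\mathsf T}|}{|C\Sigma C^{\mathsf T}|},\qquad R_2\le\tfrac1{2\eta}\log\tfrac{|C(a_2a_2^{\mathsf T}+\Sigma)C^{\mathsf T}|}{|C\Sigma C^{\mathsf T}|},\qquad R_1+R_2\le\tfrac1{2\eta}\log\tfrac{|C(AA^{\mathsf T}+\Sigma)C^{\mathsf T}|}{|C\Sigma C^{\mathsf T}|}.$$ For a $2\times\eta$ matrix $C$, the region $\mathcal R_{N,K_W}(\eta,a_1,a_2,B_1,B_2,C)$ is $\mathcal L(C)$ if $CC^{\mathsf T}$ is nonsingular; it is $\mathcal L(c)$ for a nonzero row $c$ of $C$ (any one; the choice does not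 matter) if $CC^{\mathsf T}$ is singular and $C\ne0$; and it is $\{(0,0)\}$ if $C=0$. Let $\mathcal R(P_1,P_2,N,K_W)$ be the closure of the union of $\mathcal R_{N,K_W}(\eta,a_1,a_2,B_1,B_2,C)$ over all $\eta\ge1$, $a_1,a_2\in\mathbb R^\eta$, strictly lower-triangular $B_1,B_2\in\mathbb R^{\eta\times\eta}$ and $C\in\mathbb R^{2\times\eta}$ that satisfy the trace constraints $$\operatorname{tr}\Bigl(\begin{pmatrix}I_\eta&0\end{pmatrix}Q\begin{pmatrix}I_\eta\\0\end{pmatrix}\Bigr)\le\eta P_1,\qquad \operatorname{tr}\Bigl(\begin{pmatrix}0&I_\eta\end{pmatrix}Q\begin{pmatrix}0\\I_\eta\end{pmatrix}\Bigr)\le\eta P_2 .$$ *Claim.* $\mathcal C_{\mathrm{NoisyFB}}(P_1,P_2,N,K_W)\supseteq\mathcal R(P_1,P_2,N,K_W)$. -/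

import Mathlib

open MeasureTheory ProbabilityTheory Filter Topology
open scoped Kronecker

/-! # The two-user AWGN multiple-access channel with noisy feedback

The two transmitters are indexed by `ν : Fin 2`, times `1, …, n` by `t : Fin n` (starting at `0`),
and all logarithms are natural. -/

namespace NoisyFBMAC

noncomputable section

/-! ## Channel, feedback codes and capacity region -/

/-- Law of the noise `(Z_t, (W_{1,t}, W_{2,t}))` at one time: `Z_t` is centred Gaussian of variance
`N`, the pair `(W_{1,t}, W_{2,t})` is centred Gaussian of covariance matrix `KW`, and the two are
independent. -/
def noiseLaw (N : ℝ) (KW : Matrix (Fin 2) (Fin 2) ℝ) :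
    Measure (ℝ × EuclideanSpace ℝ (Fin 2)) :=
  (gaussianReal 0 N.toNNReal).prod (multivariateGaussian 0 KW)

/-- A blocklength-`n` feedback code. Transmitter `ν` has `M ν` messages; its input at time `t` is
`enc ν t m v`, where `m` is its message and `v` lists its feedback outputs at the times before `t`.
The receiver decodes from all `n` channel outputs. -/
structure FeedbackCode (n : ℕ) where
  M : Fin 2 → ℕ
  M_pos : ∀ ν, 0 < M ν
  enc : (ν : Fin 2) → (t : Fin n) → Fin (M ν) → (Fin (t : ℕ) → ℝ) → ℝ
  measurable_enc : ∀ ν t m, Measurable (enc ν t m)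
  dec : (Fin n → ℝ) → ((ν : Fin 2) → Fin (M ν))
  measurable_dec : Measurable dec

namespace FeedbackCode

variable {n : ℕ} (c : FeedbackCode n)

/-- A sample point: the two messages, and the noise `(Z_t, (W_{1,t}, W_{2,t}))` at every time. -/
abbrev Sample : Type :=
  ((ν : Fin 2) → Fin (c.M ν)) × (Fin n → ℝ × EuclideanSpace ℝ (Fin 2))

/-- The law of a sample: independent and uniform messages, independent of the IID noise. -/
def law (N : ℝ) (KW : Matrix (Fin 2) (Fin 2) ℝ) : Measure c.Sample :=
  (Measure.pi fun ν => uniformOn (Set.univ : Set (Fin (c.M ν)))).prod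
    (Measure.pi fun _ : Fin n => noiseLaw N KW)

/-- The channel output `Y_t = X_{1,t} + X_{2,t} + Z_t`, where `X_{ν,t}` is computed from the message
`M_ν` and the earlier feedback outputs `V_{ν,s} = Y_s + W_{ν,s}`, `s < t`. -/
def output (ω : c.Sample) (t : Fin n) : ℝ :=
  (∑ ν : Fin 2, c.enc ν t (ω.1 ν) fun s : Fin (t : ℕ) =>
    output ω ⟨s, s.2.trans t.2⟩ + (ω.2 ⟨s, s.2.trans t.2⟩).2 ν) + (ω.2 t).1
termination_by (t : ℕ)
decreasing_by exact s.2

/-- The feedback output `V_{ν,t} = Y_t + W_{ν,t}`. -/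
def feedback (ω : c.Sample) (ν : Fin 2) (t : Fin n) : ℝ :=
  c.output ω t + (ω.2 t).2 ν

/-- The channel input `X_{ν,t}`. -/
def input (ω : c.Sample) (ν : Fin 2) (t : Fin n) : ℝ :=
  c.enc ν t (ω.1 ν) fun s : Fin (t : ℕ) => c.feedback ω ν ⟨s, s.2.trans t.2⟩

theorem output_eq (ω : c.Sample) (t : Fin n) :
    c.output ω t = c.input ω 0 t + c.input ω 1 t + (ω.2 t).1 := by
  rw [output, Fin.sum_univ_two]
  rfl

/-- The expected average block-power constraint `(1/n) ∑_t E[X_{ν,t}²] ≤ P` for Transmitter `ν`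
(the expectations being finite). -/
def SatisfiesPower (N : ℝ) (KW : Matrix (Fin 2) (Fin 2) ℝ) (ν : Fin 2) (P : ℝ) : Prop :=
  (∀ t, Integrable (fun ω => c.input ω ν t ^ 2) (c.law N KW)) ∧
    (1 / (n : ℝ)) * ∑ t, ∫ ω, c.input ω ν t ^ 2 ∂(c.law N KW) ≤ P

/-- The rate `(1/n) log |𝓜_ν|`. -/
def rate (ν : Fin 2) : ℝ := (1 / (n : ℝ)) * Real.log (c.M ν)

/-- The average probability of a decoding error. -/
def errorProb (N : ℝ) (KW : Matrix (Fin 2) (Fin 2) ℝ) : ℝ :=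
  (c.law N KW).real {ω | c.dec (c.output ω) ≠ ω.1}

end FeedbackCode

/-- A rate pair is achievable if for every `δ > 0` there are feedback codes satisfying the power
constraints and having rates exceeding `R₁ - δ` and `R₂ - δ`, for all sufficiently large
blocklengths, whose error probabilities tend to zero. -/
def Achievable (P₁ P₂ N : ℝ) (KW : Matrix (Fin 2) (Fin 2) ℝ) (R : ℝ × ℝ) : Prop :=
  ∀ δ > 0, ∃ c : (n : ℕ) → FeedbackCode n,
    (∀ᶠ n in atTop,
      (c n).SatisfiesPower N KW 0 P₁ ∧ (c n).SatisfiesPower N KW 1 P₂ ∧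
        R.1 - δ < (c n).rate 0 ∧ R.2 - δ < (c n).rate 1) ∧
    Tendsto (fun n => (c n).errorProb N KW) atTop (𝓝 0)

/-- The capacity region: the set of all achievable (nonnegative) rate pairs. -/
def capacityNoisyFB (P₁ P₂ N : ℝ) (KW : Matrix (Fin 2) (Fin 2) ℝ) : Set (ℝ × ℝ) :=
  {R | 0 ≤ R.1 ∧ 0 ≤ R.2 ∧ Achievable P₁ P₂ N KW R}

/-! ## The region `R(P₁, P₂, N, KW)`

Block matrices with `2η` rows or columns are indexed by `Fin 2 × Fin η`, the first component being
the number of the block; this is also the index type of `KW ⊗ I_η`. -/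

section Region

variable {η : ℕ}

/-- `(a₁ a₂)`, of size `η × 2`. -/
def Ab (a₁ a₂ : Fin η → ℝ) : Matrix (Fin η) (Fin 2) ℝ :=
  Matrix.of fun i ν => ![a₁, a₂] ν i

/-- `diag(a₁, a₂)`, of size `2η × 2`. -/
def Ad (a₁ a₂ : Fin η → ℝ) : Matrix (Fin 2 × Fin η) (Fin 2) ℝ :=
  Matrix.of fun p μ => if p.1 = μ then ![a₁, a₂] p.1 p.2 else 0

/-- `(B₁ B₂)`, of size `η × 2η`. -/
def Bb (B₁ B₂ : Matrix (Fin η) (Fin η) ℝ) : Matrix (Fin η) (Fin 2 × Fin η) ℝ :=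
  Matrix.of fun i q => ![B₁, B₂] q.1 i q.2

/-- `(B₁; B₂)` (stacked vertically), of size `2η × η`. -/
def Bt (B₁ B₂ : Matrix (Fin η) (Fin η) ℝ) : Matrix (Fin 2 × Fin η) (Fin η) ℝ :=
  Matrix.of fun p j => ![B₁, B₂] p.1 p.2 j

/-- `diag(B₁, B₂)`, of size `2η × 2η`. -/
def Bd (B₁ B₂ : Matrix (Fin η) (Fin η) ℝ) : Matrix (Fin 2 × Fin η) (Fin 2 × Fin η) ℝ :=
  Matrix.of fun p q => if p.1 = q.1 then ![B₁, B₂] p.1 p.2 q.2 else 0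

/-- `(B₁ B₁; B₂ B₂)`, of size `2η × 2η`. -/
def BB (B₁ B₂ : Matrix (Fin η) (Fin η) ℝ) : Matrix (Fin 2 × Fin η) (Fin 2 × Fin η) ℝ :=
  Matrix.of fun p q => ![B₁, B₂] p.1 p.2 q.2

/-- `N I_η + (B₁ B₂) (KW ⊗ I_η) (B₁ B₂)ᵀ`. -/
def noiseCov (N : ℝ) (KW : Matrix (Fin 2) (Fin 2) ℝ) (B₁ B₂ : Matrix (Fin η) (Fin η) ℝ) :
    Matrix (Fin η) (Fin η) ℝ :=
  N • (1 : Matrix (Fin η) (Fin η) ℝ) +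
    Bb B₁ B₂ * (KW ⊗ₖ (1 : Matrix (Fin η) (Fin η) ℝ)) * (Bb B₁ B₂).transpose

/-- `(1/(2η)) log ( |C (S + Σ) Cᵀ| / |C Σ Cᵀ| )`, with `Σ = noiseCov N KW B₁ B₂`. -/
def rateBound {m : Type} [Fintype m] [DecidableEq m] (N : ℝ) (KW : Matrix (Fin 2) (Fin 2) ℝ)
    (B₁ B₂ : Matrix (Fin η) (Fin η) ℝ) (C : Matrix m (Fin η) ℝ) (S : Matrix (Fin η) (Fin η) ℝ) :
    ℝ :=
  1 / (2 * (η : ℝ)) *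
    Real.log ((C * (S + noiseCov N KW B₁ B₂) * C.transpose).det /
      (C * noiseCov N KW B₁ B₂ * C.transpose).det)

/-- The nonnegative rate pairs satisfying the three log-determinant rate constraints. -/
def logDetRegion {m : Type} [Fintype m] [DecidableEq m] (N : ℝ) (KW : Matrix (Fin 2) (Fin 2) ℝ)
    (a₁ a₂ : Fin η → ℝ) (B₁ B₂ : Matrix (Fin η) (Fin η) ℝ) (C : Matrix m (Fin η) ℝ) :
    Set (ℝ × ℝ) :=
  {R | 0 ≤ R.1 ∧ 0 ≤ R.2 ∧
    R.1 ≤ rateBound N KW B₁ B₂ C (Matrix.vecMulVec a₁ a₁) ∧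
    R.2 ≤ rateBound N KW B₁ B₂ C (Matrix.vecMulVec a₂ a₂) ∧
    R.1 + R.2 ≤ rateBound N KW B₁ B₂ C (Ab a₁ a₂ * (Ab a₁ a₂).transpose)}

open Classical in
/-- The region `R_{N,KW}(η, a₁, a₂, B₁, B₂, C)`: if `C Cᵀ` is nonsingular, it is given by the
constraints for `C`; if `C Cᵀ` is singular and `C ≠ 0`, by the constraints for a nonzero row of
`C` (the rows being then proportional, all nonzero rows give the same constraints); and for `C = 0`
it is the origin. -/
def paramRegion (N : ℝ) (KW : Matrix (Fin 2) (Fin 2) ℝ) (a₁ a₂ : Fin η → ℝ)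
    (B₁ B₂ : Matrix (Fin η) (Fin η) ℝ) (C : Matrix (Fin 2) (Fin η) ℝ) : Set (ℝ × ℝ) :=
  if IsUnit (C * C.transpose) then logDetRegion N KW a₁ a₂ B₁ B₂ C
  else if C ≠ 0 then
    {R | ∃ i, C i ≠ 0 ∧ R ∈ logDetRegion N KW a₁ a₂ B₁ B₂ (Matrix.replicateRow Unit (C i))}
  else {(0, 0)}

/-- `(I - BB)⁻¹ (Ad Adᵀ + N Bt Btᵀ + Bd (KW ⊗ I_η) Bdᵀ) (I - BB)⁻ᵀ`. -/
def inputCov (N : ℝ) (KW : Matrix (Fin 2) (Fin 2) ℝ) (a₁ a₂ : Fin η → ℝ)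
    (B₁ B₂ : Matrix (Fin η) (Fin η) ℝ) : Matrix (Fin 2 × Fin η) (Fin 2 × Fin η) ℝ :=
  (1 - BB B₁ B₂)⁻¹ *
    (Ad a₁ a₂ * (Ad a₁ a₂).transpose + N • (Bt B₁ B₂ * (Bt B₁ B₂).transpose) +
      Bd B₁ B₂ * (KW ⊗ₖ (1 : Matrix (Fin η) (Fin η) ℝ)) * (Bd B₁ B₂).transpose) *
    ((1 - BB B₁ B₂)⁻¹).transpose

/-- The `ν`-th diagonal `η × η` block of a `2η × 2η` matrix; that is `(I 0) M (I 0)ᵀ` for the first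
transmitter and `(0 I) M (0 I)ᵀ` for the second one. -/
def diagBlock (M : Matrix (Fin 2 × Fin η) (Fin 2 × Fin η) ℝ) (ν : Fin 2) :
    Matrix (Fin η) (Fin η) ℝ :=
  M.submatrix (fun i => (ν, i)) (fun i => (ν, i))

/-- The two trace constraints. -/
def TraceConstraints (P₁ P₂ N : ℝ) (KW : Matrix (Fin 2) (Fin 2) ℝ) (a₁ a₂ : Fin η → ℝ)
    (B₁ B₂ : Matrix (Fin η) (Fin η) ℝ) : Prop :=
  (diagBlock (inputCov N KW a₁ a₂ B₁ B₂) 0).trace ≤ η * P₁ ∧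
    (diagBlock (inputCov N KW a₁ a₂ B₁ B₂) 1).trace ≤ η * P₂

/-- Strictly lower-triangular matrices. -/
def StrictlyLower (B : Matrix (Fin η) (Fin η) ℝ) : Prop :=
  ∀ i j, i ≤ j → B i j = 0

end Region

/-- The region `R(P₁, P₂, N, KW)`. -/
def region (P₁ P₂ N : ℝ) (KW : Matrix (Fin 2) (Fin 2) ℝ) : Set (ℝ × ℝ) :=
  closure {R | ∃ (η : ℕ) (a₁ a₂ : Fin η → ℝ) (B₁ B₂ : Matrix (Fin η) (Fin η) ℝ)
    (C : Matrix (Fin 2) (Fin η) ℝ), 0 < η ∧ StrictlyLower B₁ ∧ StrictlyLower B₂ ∧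
      TraceConstraints P₁ P₂ N KW a₁ a₂ B₁ B₂ ∧ R ∈ paramRegion N KW a₁ a₂ B₁ B₂ C}

end

end NoisyFBMAC

/-!
Both transmitters use the channel in blocks of length `η` and superpose a linear function of their
feedback in the block, given by `B₁` and `B₂`, on one code symbol times `a₁` and `a₂`. Since the
receiver knows its outputs `Y` in the block, it can form
`Y - (B₁ + B₂) Y = x₁ a₁ + x₂ a₂ + U`, where `U` has covariance matrix `N I + B (KW ⊗ I) Bᵀ`. The
blocks thus constitute a memoryless multiple-access channel from pairs of symbols to `ℝ^η`, to
which random coding with standard Gaussian codebooks applies. The decoder sees the output through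
`C` and compares, for each nonempty set of users, the Gaussian information density with a threshold;
by the law of large numbers the density of the transmitted pair concentrates at the
log-determinants of the region. Scaling `a₁` and `a₂` down slightly leaves room for the fluctuation
of the power of the codebooks, and the scale tends to `1` because the rate bounds are continuous.
-/

namespace NoisyFBMAC

open scoped ENNReal Matrix

section Codebooks

variable {ι X : Type*} {M : ι → Type*}

/-- The tuple of codewords that a codebook `c`, listing the codeword of each message of each user,
assigns to the tuple of messages `m`. -/
def codeword (c : ∀ ν, M ν → X) (m : ∀ ν, M ν) : ι → X := fun ν => c ν (m ν)

theorem measurable_codeword [MeasurableSpace X] (m : ∀ ν, M ν) :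
    Measurable fun c : ∀ ν, M ν → X => codeword c m := by
  unfold codeword; fun_prop

theorem measurable_piecewise [DecidableEq ι] [MeasurableSpace X] (T : Finset ι) :
    Measurable fun q : (ι → X) × (ι → X) => T.piecewise q.1 q.2 :=
  measurable_pi_lambda _ fun ν => by
    by_cases hν : ν ∈ T <;> simp only [Finset.piecewise, hν, if_true, if_false] <;> fun_prop

variable [Fintype ι]

/-- The set of users whose messages in `m` and `m'` differ. -/
def diffUsers [∀ ν, DecidableEq (M ν)] (m m' : ∀ ν, M ν) : Finset ι := {ν | m' ν ≠ m ν}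

theorem diffUsers_nonempty_iff [∀ ν, DecidableEq (M ν)] {m m' : ∀ ν, M ν} :
    (diffUsers m m').Nonempty ↔ m' ≠ m := by
  simp [diffUsers, Finset.Nonempty, Function.ne_iff]

variable [∀ ν, Fintype (M ν)] [MeasurableSpace X]

/-- The law of a random codebook, the codewords of user `ν` being drawn independently from `p ν`. -/
noncomputable def codebookLaw (p : ι → Measure X) (M : ι → Type*) [∀ ν, Fintype (M ν)] :
    Measure (∀ ν, M ν → X) :=
  Measure.pi fun ν => Measure.pi fun _ => p ν

variable {p : ι → Measure X} [∀ ν, IsProbabilityMeasure (p ν)]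

instance : IsProbabilityMeasure (codebookLaw p M) := by
  unfold codebookLaw; infer_instance

theorem measurePreserving_codeword (m : ∀ ν, M ν) :
    MeasurePreserving (codeword · m) (codebookLaw p M) (Measure.pi p) :=
  measurePreserving_pi _ _ fun ν => measurePreserving_eval (fun _ => p ν) (m ν)

theorem measurePreserving_eval_pair {κ : Type*} [Fintype κ] [DecidableEq κ] (μ : Measure X)
    [IsProbabilityMeasure μ] (i j : κ) :
    MeasurePreserving (fun c : κ → X => (c i, c j)) (Measure.pi fun _ => μ)
      ((μ.prod μ).map fun q => (q.1, if j ≠ i then q.2 else q.1)) := by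
  by_cases hij : j = i
  · have hdiag : Measurable fun x : X => (x, x) := by fun_prop
    have hleft := Measure.map_map (μ := Measure.pi fun _ => μ) hdiag (measurable_pi_apply i)
    have hright := Measure.map_map (μ := μ.prod μ) hdiag measurable_fst
    rw [(measurePreserving_eval (fun _ => μ) i).map_eq] at hleft
    rw [measurePreserving_fst.map_eq] at hright
    refine ⟨by fun_prop, ?_⟩
    simpa [hij, Function.comp_def] using hleft.symm.trans hright
  · have hindep : IndepFun (fun c : κ → X => c i) (fun c => c j) (Measure.pi fun _ => μ) :=
      (iIndepFun_pi (X := fun _ x => x) fun _ => measurable_id.aemeasurable).indepFun (Ne.symm hij)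
    have hmap := (indepFun_iff_map_prod_eq_prod_map_map (measurable_pi_apply i).aemeasurable
      (measurable_pi_apply j).aemeasurable).1 hindep
    refine ⟨by fun_prop, ?_⟩
    simpa [hij, (measurePreserving_eval (fun _ : κ => μ) _).map_eq] using hmap

variable [DecidableEq ι] [∀ ν, DecidableEq (M ν)]

theorem lintegral_codeword_codeword (m m' : ∀ ν, M ν) {φ : (ι → X) × (ι → X) → ℝ≥0∞}
    (hφ : Measurable φ) :
    ∫⁻ c, φ (codeword c m, codeword c m') ∂(codebookLaw p M) =
      ∫⁻ x, ∫⁻ x', φ (x, (diffUsers m m').piecewise x' x) ∂(Measure.pi p) ∂(Measure.pi p) := by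
  have hcode := measurePreserving_pi _ _
    fun ν => measurePreserving_eval_pair (p ν) (m ν) (m' ν)
  have hpair := measurePreserving_pi (fun ν => (p ν).prod (p ν)) _ fun ν =>
    (Measurable.measurePreserving (f := fun q : X × X => (q.1, if m' ν ≠ m ν then q.2 else q.1))
      (by split_ifs <;> fun_prop) ((p ν).prod (p ν)))
  have hzip := (measurePreserving_arrowProdEquivProdArrow X X ι p p).symm
  have hψ : Measurable fun q : ι → X × X => φ (fun ν => (q ν).1, fun ν => (q ν).2) := by fun_prop
  calc ∫⁻ c, φ (codeword c m, codeword c m') ∂(codebookLaw p M)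
      = _ := hcode.lintegral_comp hψ
    _ = _ := ((hpair.comp hzip).lintegral_comp hψ).symm
    _ = ∫⁻ q, φ (q.1, (diffUsers m m').piecewise q.2 q.1)
          ∂((Measure.pi p).prod (Measure.pi p)) := by
        refine lintegral_congr fun q => congrArg φ (Prod.ext rfl (funext fun ν => ?_))
        simp [diffUsers, Finset.piecewise, MeasurableEquiv.arrowProdEquivProdArrow,
          Equiv.arrowProdEquivProdArrow]
    _ = _ := lintegral_prod _ (hφ.comp (measurable_fst.prodMk
        ((measurable_piecewise _).comp measurable_swap))).aemeasurable

theorem card_filter_diffUsers_eq (m : ∀ ν, M ν) (T : Finset ι) :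
    ({m' | diffUsers m m' = T} : Finset (∀ ν, M ν)).card =
      ∏ ν ∈ T, (Fintype.card (M ν) - 1) := by
  have hfiber : ({m' | diffUsers m m' = T} : Finset (∀ ν, M ν)) =
      Fintype.piFinset fun ν => if ν ∈ T then Finset.univ.erase (m ν) else {m ν} := by
    ext m'
    simp only [diffUsers, Finset.mem_filter_univ, Finset.ext_iff, Fintype.mem_piFinset]
    refine forall_congr' fun ν => ?_
    by_cases hν : ν ∈ T <;> simp [hν]
  simp only [hfiber, Fintype.card_piFinset, apply_ite Finset.card, Finset.card_singleton,
    Finset.card_erase_of_mem (Finset.mem_univ _), Finset.card_univ, Finset.prod_ite_mem,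
    Finset.univ_inter]

theorem sum_comp_diffUsers (m : ∀ ν, M ν) (f : Finset ι → ℝ≥0∞) :
    ∑ m' with m' ≠ m, f (diffUsers m m') =
      ∑ T with T.Nonempty, ((∏ ν ∈ T, (Fintype.card (M ν) - 1) : ℕ) : ℝ≥0∞) * f T := by
  rw [← Finset.sum_fiberwise_of_maps_to (t := {T | T.Nonempty}) (g := diffUsers m)
    (by simp +contextual [diffUsers_nonempty_iff])]
  refine Finset.sum_congr rfl fun T hT => ?_
  have hfiber : ({m' ∈ ({m' | m' ≠ m} : Finset (∀ ν, M ν)) | diffUsers m m' = T}) =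
      ({m' | diffUsers m m' = T} : Finset (∀ ν, M ν)) := by
    ext m'
    simp only [Finset.mem_filter, Finset.mem_univ, true_and, ← diffUsers_nonempty_iff] at hT ⊢
    exact ⟨And.right, fun h => ⟨h ▸ hT, h⟩⟩
  rw [hfiber, Finset.sum_congr rfl fun m' hm' => congrArg f (Finset.mem_filter.1 hm').2,
    Finset.sum_const, card_filter_diffUsers_eq, nsmul_eq_mul]

end Codebooks

section ThresholdDecoding

open Classical in
/-- The element of a singleton (and an arbitrary element for any other set): the receiver decodes
to the only message tuple passing its threshold tests. -/
noncomputable def pickUnique {α : Type*} [Nonempty α] (S : Set α) : α :=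
  if h : ∃ a, S = {a} then h.choose else Classical.arbitrary α

theorem pickUnique_singleton {α : Type*} [Nonempty α] (a : α) : pickUnique {a} = a := by
  have h : ∃ b, ({a} : Set α) = {b} := ⟨a, rfl⟩
  rw [pickUnique, dif_pos h]
  exact (Set.singleton_injective h.choose_spec).symm

theorem measurable_pickUnique {α Y : Type*} [Finite α] [Nonempty α] [MeasurableSpace α]
    [MeasurableSpace Y] {S : Y → Set α} (hS : ∀ a, MeasurableSet {y | a ∈ S y}) :
    Measurable fun y => pickUnique (S y) := by
  have hmeas : Measurable S := measurable_set_iff.2 fun a => measurableSet_setOfPred.1 (hS a)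
  have hpick : Measurable (pickUnique : Set α → α) := by
    have := Fintype.ofFinite α
    have : DiscreteMeasurableSpace (Set α) := inferInstanceAs (DiscreteMeasurableSpace (α → Prop))
    exact Measurable.of_discrete
  exact hpick.comp hmeas

variable {ι X Y : Type*} [Fintype ι] [DecidableEq ι]

/-- The pairs of inputs and output failing one of the threshold tests `γ T ≤ i T x y`. -/
def thresholdFailure (i : Finset ι → (ι → X) → Y → ℝ) (γ : Finset ι → ℝ) : Set ((ι → X) × Y) :=
  {q | ∃ T : Finset ι, T.Nonempty ∧ i T q.1 q.2 < γ T}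

variable {M : ι → Type*}

/-- Decoding to the message tuple whose codewords, alone, pass all the threshold tests. -/
noncomputable def thresholdDecoder [∀ ν, Nonempty (M ν)] (i : Finset ι → (ι → X) → Y → ℝ)
    (γ : Finset ι → ℝ) (c : ∀ ν, M ν → X) (y : Y) : ∀ ν, M ν :=
  pickUnique {m | (codeword c m, y) ∉ thresholdFailure i γ}

/-- A bound on the error event of the threshold decoder when `m` is sent and `y` received, whose
terms stand for the true codewords failing a test and for wrong ones passing theirs. -/
noncomputable def errorBound [∀ ν, Fintype (M ν)] [∀ ν, DecidableEq (M ν)]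
    (i : Finset ι → (ι → X) → Y → ℝ) (γ : Finset ι → ℝ)
    (c : ∀ ν, M ν → X) (m : ∀ ν, M ν) (y : Y) : ℝ≥0∞ :=
  (thresholdFailure i γ).indicator 1 (codeword c m, y) +
    ∑ m' with m' ≠ m, ENNReal.ofReal
      (Real.exp (i (diffUsers m m') (codeword c m') y - γ (diffUsers m m')))

theorem one_le_errorBound [∀ ν, Fintype (M ν)] [∀ ν, DecidableEq (M ν)] [∀ ν, Nonempty (M ν)]
    {i : Finset ι → (ι → X) → Y → ℝ} {γ : Finset ι → ℝ} {c : ∀ ν, M ν → X}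
    {m : ∀ ν, M ν} {y : Y} (herr : thresholdDecoder i γ c y ≠ m) :
    1 ≤ errorBound i γ c m y := by
  by_cases hm : (codeword c m, y) ∈ thresholdFailure i γ
  · simp [errorBound, hm]
  obtain ⟨m', hm', hne⟩ : ∃ m', (codeword c m', y) ∉ thresholdFailure i γ ∧ m' ≠ m := by
    by_contra! huniq
    refine herr ?_
    rw [thresholdDecoder, show {m | (codeword c m, y) ∉ thresholdFailure i γ} = {m} from
      Set.eq_singleton_iff_unique_mem.2 ⟨hm, huniq⟩, pickUnique_singleton]
  have hpass : γ (diffUsers m m') ≤ i (diffUsers m m') (codeword c m') y := by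
    by_contra! hlt
    exact hm' ⟨_, diffUsers_nonempty_iff.2 hne, hlt⟩
  refine le_trans ?_ (le_add_left (Finset.single_le_sum (fun _ _ => zero_le)
    (Finset.mem_filter.2 ⟨Finset.mem_univ m', hne⟩)))
  rw [← ENNReal.ofReal_one]
  exact ENNReal.ofReal_le_ofReal (Real.one_le_exp (sub_nonneg.2 hpass))

variable [MeasurableSpace X] [MeasurableSpace Y]

/-- A family of information densities for independent inputs of laws `p`: `i T x y` compares the
likelihood of the output `y` under the inputs `x` with its likelihood when the inputs of the users
in `T` are redrawn. Only Markov's bound on the redrawn inputs is required. -/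
structure IsInformationDensity (p : ι → Measure X) (i : Finset ι → (ι → X) → Y → ℝ) : Prop where
  measurable : ∀ T, Measurable (Function.uncurry (i T))
  lintegral_exp_le_one : ∀ T : Finset ι, T.Nonempty → ∀ x y,
    ∫⁻ x', ENNReal.ofReal (Real.exp (i T (T.piecewise x' x) y)) ∂(Measure.pi p) ≤ 1

variable {p : ι → Measure X} {i : Finset ι → (ι → X) → Y → ℝ}

theorem measurableSet_thresholdFailure (hi : IsInformationDensity p i) (γ : Finset ι → ℝ) :
    MeasurableSet (thresholdFailure i γ) := by
  simp only [thresholdFailure, Set.ofPred_exists, Set.ofPred_and]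
  exact .iUnion fun T => (MeasurableSet.const _).inter
    (measurableSet_lt (hi.measurable T) measurable_const)

theorem measurable_thresholdDecoder [∀ ν, Finite (M ν)] [∀ ν, Nonempty (M ν)]
    [∀ ν, MeasurableSpace (M ν)]
    (hi : IsInformationDensity p i) (γ : Finset ι → ℝ) (c : ∀ ν, M ν → X) :
    Measurable (thresholdDecoder i γ c) :=
  measurable_pickUnique fun m =>
    (measurable_prodMk_left (x := codeword c m) (measurableSet_thresholdFailure hi γ)).compl

theorem IsInformationDensity.measurable_exp_sub (hi : IsInformationDensity p i) (T : Finset ι)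
    (r : ℝ) : Measurable fun q : (ι → X) × Y => ENNReal.ofReal (Real.exp (i T q.1 q.2 - r)) :=
  (Real.measurable_exp.comp ((hi.measurable T).sub_const r)).ennreal_ofReal

end ThresholdDecoding

section OneShot

variable {ι X Y Ω : Type*} [MeasurableSpace X] [MeasurableSpace Y] [MeasurableSpace Ω]
  {M : ι → Type*} {h : (ι → X) → Ω → Y}

theorem measurable_codeword_channel (hh : Measurable (Function.uncurry h)) (m m' : ∀ ν, M ν) :
    Measurable fun q : (∀ ν, M ν → X) × Ω => (codeword q.1 m', h (codeword q.1 m) q.2) :=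
  ((measurable_codeword m').comp measurable_fst).prodMk
    (hh.comp (((measurable_codeword m).comp measurable_fst).prodMk measurable_snd))

variable [Fintype ι] [DecidableEq ι] [∀ ν, Fintype (M ν)] [∀ ν, DecidableEq (M ν)]
  {p : ι → Measure X} {P : Measure Ω} {i : Finset ι → (ι → X) → Y → ℝ}

theorem measurable_errorBound (hh : Measurable (Function.uncurry h))
    (hi : IsInformationDensity p i) (γ : Finset ι → ℝ) (m : ∀ ν, M ν) :
    Measurable fun q : (∀ ν, M ν → X) × Ω => errorBound i γ q.1 m (h (codeword q.1 m) q.2) :=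
  ((measurable_one.indicator (measurableSet_thresholdFailure hi γ)).comp
    (measurable_codeword_channel hh m m)).add (Finset.measurable_sum _ fun m' _ =>
      (hi.measurable_exp_sub _ _).comp (measurable_codeword_channel hh m m'))

variable [∀ ν, IsProbabilityMeasure (p ν)] [IsProbabilityMeasure P]

theorem lintegral_codeword_channel_le (hh : Measurable (Function.uncurry h)) (m m' : ∀ ν, M ν)
    {g : (ι → X) → Y → ℝ≥0∞} (hg : Measurable (Function.uncurry g)) {ε : ℝ≥0∞}
    (hε : ∀ x y, ∫⁻ x', g ((diffUsers m m').piecewise x' x) y ∂(Measure.pi p) ≤ ε) :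
    ∫⁻ c, ∫⁻ ω, g (codeword c m') (h (codeword c m) ω) ∂P ∂(codebookLaw p M) ≤ ε := by
  have hgh : Measurable fun q : ((ι → X) × (ι → X)) × Ω => g q.1.2 (h q.1.1 q.2) :=
    hg.comp (measurable_fst.snd.prodMk (hh.comp (measurable_fst.fst.prodMk measurable_snd)))
  have hpiece (x : ι → X) : Measurable fun q : (ι → X) × Ω =>
      g ((diffUsers m m').piecewise q.1 x) (h x q.2) :=
    hgh.comp ((measurable_const.prodMk ((measurable_piecewise _).comp
      (measurable_fst.prodMk measurable_const))).prodMk measurable_snd)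
  calc _ = ∫⁻ x, ∫⁻ x', ∫⁻ ω, g ((diffUsers m m').piecewise x' x) (h x ω) ∂P
          ∂(Measure.pi p) ∂(Measure.pi p) :=
        lintegral_codeword_codeword m m' hgh.lintegral_prod_right'
    _ = ∫⁻ x, ∫⁻ ω, ∫⁻ x', g ((diffUsers m m').piecewise x' x) (h x ω)
          ∂(Measure.pi p) ∂P ∂(Measure.pi p) :=
        lintegral_congr fun x => lintegral_lintegral_swap (hpiece x).aemeasurable
    _ ≤ ∫⁻ _, ∫⁻ _, ε ∂P ∂(Measure.pi p) := by
        gcongr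
        exact hε _ _
    _ = ε := by simp

theorem lintegral_exp_wrong_codeword_le (hh : Measurable (Function.uncurry h))
    (hi : IsInformationDensity p i) (r : ℝ) {m m' : ∀ ν, M ν} (hne : m' ≠ m) :
    ∫⁻ c, ∫⁻ ω, ENNReal.ofReal (Real.exp
        (i (diffUsers m m') (codeword c m') (h (codeword c m) ω) - r)) ∂P ∂(codebookLaw p M) ≤
      ENNReal.ofReal (Real.exp (-r)) := by
  refine lintegral_codeword_channel_le hh m m'
    (g := fun x y => ENNReal.ofReal (Real.exp (i (diffUsers m m') x y - r)))
    (hi.measurable_exp_sub _ r) fun x y => ?_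
  have hexp (t : ℝ) : ENNReal.ofReal (Real.exp (t - r)) =
      ENNReal.ofReal (Real.exp (-r)) * ENNReal.ofReal (Real.exp t) := by
    rw [← ENNReal.ofReal_mul (Real.exp_nonneg _), ← Real.exp_add, neg_add_eq_sub]
  simp only [hexp]
  rw [lintegral_const_mul' _ _ ENNReal.ofReal_ne_top]
  exact mul_le_of_le_one_right' (hi.lintegral_exp_le_one _ (diffUsers_nonempty_iff.2 hne) x y)

theorem lintegral_errorBound_le (hh : Measurable (Function.uncurry h))
    (hi : IsInformationDensity p i) (γ : Finset ι → ℝ) (m : ∀ ν, M ν) :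
    ∫⁻ c, ∫⁻ ω, errorBound i γ c m (h (codeword c m) ω) ∂P ∂(codebookLaw p M) ≤
      ((Measure.pi p).prod P) {q | (q.1, h q.1 q.2) ∈ thresholdFailure i γ} +
        ∑ T with T.Nonempty, ((∏ ν ∈ T, (Fintype.card (M ν) - 1) : ℕ) : ℝ≥0∞) *
          ENNReal.ofReal (Real.exp (-γ T)) := by
  have hfail : MeasurableSet {q : (ι → X) × Ω | (q.1, h q.1 q.2) ∈ thresholdFailure i γ} :=
    (measurable_fst.prodMk hh) (measurableSet_thresholdFailure hi γ)
  have hcode := (measurePreserving_codeword (p := p) m).prod (MeasurePreserving.id P)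
  have hwrong (m' : ∀ ν, M ν) : Measurable fun q : (∀ ν, M ν → X) × Ω => ENNReal.ofReal (Real.exp
      (i (diffUsers m m') (codeword q.1 m') (h (codeword q.1 m) q.2) - γ (diffUsers m m'))) :=
    (hi.measurable_exp_sub _ _).comp (measurable_codeword_channel hh m m')
  rw [← lintegral_prod _ (measurable_errorBound hh hi γ m).aemeasurable]
  unfold errorBound
  rw [lintegral_add_right _ (Finset.measurable_sum _ fun m' _ => hwrong m'),
    lintegral_finsetSum _ fun m' _ => hwrong m', ← sum_comp_diffUsers m]
  refine add_le_add (le_of_eq ?_) (Finset.sum_le_sum fun m' hm' => ?_)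
  · exact (hcode.lintegral_comp (measurable_one.indicator hfail)).trans
      (lintegral_indicator_one hfail)
  · rw [lintegral_prod _ (hwrong m').aemeasurable]
    exact lintegral_exp_wrong_codeword_le hh hi _ (Finset.mem_filter.1 hm').2

omit [∀ ν, DecidableEq (M ν)] in
theorem exists_code_of_isInformationDensity [∀ ν, Nonempty (M ν)] [∀ ν, MeasurableSpace (M ν)]
    [∀ ν, MeasurableSingletonClass (M ν)] (hh : Measurable (Function.uncurry h))
    (hi : IsInformationDensity p i) (γ : Finset ι → ℝ) {cost : (ι → X) → ℝ≥0∞}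
    (hcost : Measurable cost) (π : Measure (∀ ν, M ν)) [IsProbabilityMeasure π] :
    ∃ (c : ∀ ν, M ν → X) (dec : Y → ∀ ν, M ν), Measurable dec ∧
      ∫⁻ m, (P {ω | dec (h (codeword c m) ω) ≠ m} + cost (codeword c m)) ∂π ≤
        ((Measure.pi p).prod P) {q | (q.1, h q.1 q.2) ∈ thresholdFailure i γ} +
          ∑ T with T.Nonempty, ((∏ ν ∈ T, (Fintype.card (M ν) - 1) : ℕ) : ℝ≥0∞) *
            ENNReal.ofReal (Real.exp (-γ T)) + ∫⁻ x, cost x ∂(Measure.pi p) := by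
  classical
  set F : (∀ ν, M ν → X) → (∀ ν, M ν) → ℝ≥0∞ := fun c m =>
    ∫⁻ ω, errorBound i γ c m (h (codeword c m) ω) ∂P + cost (codeword c m)
  have hcostm (m : ∀ ν, M ν) := hcost.comp (measurable_codeword (X := X) m)
  have hF : Measurable (Function.uncurry F) := measurable_from_prod_countable_left fun m =>
    (measurable_errorBound hh hi γ m).lintegral_prod_right'.add (hcostm m)
  have hmean (m : ∀ ν, M ν) := (lintegral_add_right (μ := codebookLaw p M)
    (fun c => ∫⁻ ω, errorBound i γ c m (h (codeword c m) ω) ∂P) (hcostm m)).trans_le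
      (add_le_add (lintegral_errorBound_le hh hi γ m)
        ((measurePreserving_codeword m).lintegral_comp hcost).le)
  obtain ⟨c, hc⟩ := exists_le_lintegral (μ := codebookLaw p M) (f := fun c => ∫⁻ m, F c m ∂π)
    hF.lintegral_prod_right'.aemeasurable
  refine ⟨c, thresholdDecoder i γ c, measurable_thresholdDecoder hi γ c, ?_⟩
  calc _ ≤ ∫⁻ m, F c m ∂π := by
        refine lintegral_mono fun m => add_le_add_left ?_ _
        calc _ ≤ P {ω | 1 ≤ errorBound i γ c m (h (codeword c m) ω)} :=
              measure_mono fun ω hω => one_le_errorBound hω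
          _ ≤ _ := by
              simpa using mul_meas_ge_le_lintegral
                ((measurable_errorBound hh hi γ m).comp measurable_prodMk_left) 1
    _ ≤ _ := hc
    _ = ∫⁻ m, ∫⁻ c, F c m ∂(codebookLaw p M) ∂π := lintegral_lintegral_swap hF.aemeasurable
    _ ≤ _ := (lintegral_mono hmean).trans (by rw [lintegral_const, measure_univ, mul_one])

end OneShot

section ProductMeasures

theorem tendsto_lintegral_pi_average_sub {S : Type*} [MeasurableSpace S] (μ : Measure S)
    [IsProbabilityMeasure μ] {f : S → ℝ} (hf : Measurable f) (hfi : Integrable f μ) :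
    Tendsto (fun k : ℕ => ∫⁻ x, ‖(k : ℝ)⁻¹ * ∑ b, f (x b) - ∫ s, f s ∂μ‖ₑ
      ∂(Measure.pi fun _ : Fin k => μ)) atTop (𝓝 0) := by
  set P := Measure.infinitePi fun _ : ℕ => μ
  have heval (i : ℕ) : MeasurePreserving (fun x : ℕ → S => x i) P μ :=
    measurePreserving_eval_infinitePi (fun _ : ℕ => μ) i
  have hident (i : ℕ) : IdentDistrib (fun x : ℕ → S => f (x i)) (fun x => f (x 0)) P P :=
    IdentDistrib.comp ⟨(heval i).measurable.aemeasurable, (heval 0).measurable.aemeasurable,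
      (heval i).map_eq.trans (heval 0).map_eq.symm⟩ hf
  have hmean : ∫ x, f (x 0) ∂P = ∫ s, f s ∂μ := by
    rw [← (heval 0).map_eq, integral_map (heval 0).measurable.aemeasurable hf.aestronglyMeasurable]
  have hslln := strong_law_Lp (μ := P) (p := 1) le_rfl ENNReal.one_ne_top (fun i x => f (x i))
    (memLp_one_iff_integrable.2 ((heval 0).integrable_comp_of_integrable hfi))
    (fun i j hij => (iIndepFun_infinitePi (P := fun _ : ℕ => μ) (X := fun _ => f)
      fun _ => hf).indepFun hij) hident
  refine hslln.congr fun k => ?_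
  have hrestrict : Measure.map (fun (x : ℕ → S) (b : Fin k) => x b) P =
      Measure.pi fun _ : Fin k => μ := by
    rw [Measure.map_infinitePi_infinitePi_of_inj Fin.val_injective, Measure.infinitePi_eq_pi]
  rw [eLpNorm_one_eq_lintegral_enorm, hmean, ← hrestrict,
    lintegral_map (by fun_prop) (by fun_prop)]
  simp [Finset.sum_range]

theorem tendsto_measure_pi_sum_lt {S : Type*} [MeasurableSpace S] (μ : Measure S)
    [IsProbabilityMeasure μ] {f : S → ℝ} (hf : Measurable f) (hfi : Integrable f μ) {r : ℝ}
    (hr : r < ∫ s, f s ∂μ) :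
    Tendsto (fun k : ℕ => (Measure.pi fun _ : Fin k => μ) {x | ∑ b, f (x b) < k * r})
      atTop (𝓝 0) := by
  have hmeas {k : ℕ} : Measurable fun x : Fin k → S =>
    ‖(k : ℝ)⁻¹ * ∑ b, f (x b) - ∫ s, f s ∂μ‖ₑ := by fun_prop
  set δ := ∫ s, f s ∂μ - r
  have hδ : 0 < δ := sub_pos.2 hr
  have hlim := ENNReal.Tendsto.div_const (tendsto_lintegral_pi_average_sub μ hf hfi)
    (Or.inr (ENNReal.ofReal_pos.2 hδ).ne')
  rw [ENNReal.zero_div] at hlim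
  refine tendsto_of_tendsto_of_tendsto_of_le_of_le tendsto_const_nhds hlim (fun _ => zero_le)
    fun k => (measure_mono ?_).trans (meas_ge_le_lintegral_div hmeas.aemeasurable
      (ENNReal.ofReal_pos.2 hδ).ne' ENNReal.ofReal_ne_top)
  intro x (hx : ∑ b, f (x b) < k * r)
  have hk : (0 : ℝ) < k := by
    rcases k.eq_zero_or_pos with rfl | hk
    · simp at hx
    · exact_mod_cast hk
  have havg : (k : ℝ)⁻¹ * ∑ b, f (x b) < r := by rwa [inv_mul_lt_iff₀ hk]
  rw [Set.mem_ofPred_eq, Real.enorm_eq_ofReal_abs]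
  exact ENNReal.ofReal_le_ofReal (le_abs.2 (Or.inr (by grind)))

theorem measurePreserving_pi_swap {ι κ X : Type*} [Fintype ι] [Fintype κ] [MeasurableSpace X]
    (μ : ι → κ → Measure X) [∀ i j, IsProbabilityMeasure (μ i j)] :
    MeasurePreserving (fun (x : ι → κ → X) j i => x i j)
      (Measure.pi fun i => Measure.pi (μ i)) (Measure.pi fun j => Measure.pi fun i => μ i j) := by
  have hcurry := Measure.infinitePi_map_curry μ
  have hcurry' := Measure.infinitePi_map_curry fun j i => μ i j
  have hswap := Measure.map_infinitePi_infinitePi_of_inj (P := fun q : ι × κ => μ q.1 q.2)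
    (Prod.swap_injective (α := κ) (β := ι))
  simp only [Measure.infinitePi_eq_pi, Prod.fst_swap, Prod.snd_swap] at hcurry hcurry' hswap
  refine ⟨by fun_prop, ?_⟩
  rw [← hcurry, ← hcurry', ← hswap, Measure.map_map (by fun_prop) (MeasurableEquiv.measurable _),
    Measure.map_map (MeasurableEquiv.measurable _) (by fun_prop)]
  rfl

theorem measurePreserving_pi_curry_of_injective {κ τ σ X : Type*} [Fintype κ] [Fintype τ]
    [Fintype σ] [MeasurableSpace X] (μ : Measure X) [IsProbabilityMeasure μ] {g : κ × τ → σ}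
    (hg : Function.Injective g) :
    MeasurePreserving (fun (x : σ → X) j i => x (g (j, i))) (Measure.pi fun _ => μ)
      (Measure.pi fun _ => Measure.pi fun _ => μ) := by
  have hinj := Measure.map_infinitePi_infinitePi_of_inj (P := fun _ : σ => μ) hg
  have hcurry := Measure.infinitePi_map_curry fun (_ : κ) (_ : τ) => μ
  simp only [Measure.infinitePi_eq_pi] at hinj hcurry
  refine ⟨by fun_prop, ?_⟩
  rw [← hcurry, ← hinj, Measure.map_map (MeasurableEquiv.measurable _) (by fun_prop)]
  rfl

theorem lintegral_pi_prod {κ : Type*} [Fintype κ] {S : κ → Type*} [∀ b, MeasurableSpace (S b)]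
    (μ : ∀ b, Measure (S b)) [∀ b, IsProbabilityMeasure (μ b)] {f : ∀ b, S b → ℝ≥0∞}
    (hf : ∀ b, Measurable (f b)) :
    ∫⁻ x, ∏ b, f b (x b) ∂(Measure.pi μ) = ∏ b, ∫⁻ s, f b s ∂(μ b) := by
  refine (lintegral_prod_eq_prod_lintegral_of_indepFun Finset.univ
    (fun b (x : ∀ b, S b) => f b (x b)) (iIndepFun_pi fun b => (hf b).aemeasurable)
    fun b => by fun_prop).trans ?_
  exact Finset.prod_congr rfl fun b _ => (measurePreserving_eval μ b).lintegral_comp (hf b)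

end ProductMeasures

section BlockCodes

variable {ι κ X Y Ω : Type*}

/-- `κ` uses of a memoryless channel. -/
def blockChannel (h : (ι → X) → Ω → Y) (x : ι → κ → X) (ω : κ → Ω) (b : κ) : Y :=
  h (fun ν => x ν b) (ω b)

/-- The information density of `κ` uses of a memoryless channel. -/
def blockDensity [Fintype κ] (i : Finset ι → (ι → X) → Y → ℝ) (T : Finset ι) (x : ι → κ → X)
    (y : κ → Y) : ℝ :=
  ∑ b, i T (fun ν => x ν b) (y b)

variable [MeasurableSpace X] [MeasurableSpace Y] [MeasurableSpace Ω] {h : (ι → X) → Ω → Y}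

theorem measurable_blockChannel (hh : Measurable (Function.uncurry h)) :
    Measurable (Function.uncurry (blockChannel (κ := κ) h)) :=
  measurable_pi_iff.2 fun b => hh.comp (f := fun q : (ι → κ → X) × (κ → Ω) =>
    (fun ν => q.1 ν b, q.2 b)) (by fun_prop)

variable [Fintype ι] [Fintype κ] {p : ι → Measure X} [∀ ν, IsProbabilityMeasure (p ν)]
  {P : Measure Ω} [IsProbabilityMeasure P] {i : Finset ι → (ι → X) → Y → ℝ}

theorem measurePreserving_blocks (p : ι → Measure X) [∀ ν, IsProbabilityMeasure (p ν)]
    (P : Measure Ω) [IsProbabilityMeasure P] :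
    MeasurePreserving (fun (q : (ι → κ → X) × (κ → Ω)) b => (fun ν => q.1 ν b, q.2 b))
      ((Measure.pi fun ν => Measure.pi fun _ => p ν).prod (Measure.pi fun _ => P))
      (Measure.pi fun _ => (Measure.pi p).prod P) :=
  ((measurePreserving_arrowProdEquivProdArrow _ _ κ (fun _ => Measure.pi p)
    (fun _ => P)).symm).comp ((measurePreserving_pi_swap fun ν (_ : κ) => p ν).prod (.id _))

theorem tendsto_lintegral_block_average_sub {f : (ι → X) → ℝ} (hf : Measurable f)
    (hfi : Integrable f (Measure.pi p)) :
    Tendsto (fun k : ℕ => ∫⁻ x, ‖(k : ℝ)⁻¹ * ∑ b, f (fun ν => x ν b) - ∫ s, f s ∂(Measure.pi p)‖ₑ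
      ∂(Measure.pi fun ν => Measure.pi fun _ : Fin k => p ν)) atTop (𝓝 0) := by
  refine (tendsto_lintegral_pi_average_sub _ hf hfi).congr fun k => Eq.symm ?_
  exact (measurePreserving_pi_swap fun ν (_ : Fin k) => p ν).lintegral_comp
    (f := fun x => ‖(k : ℝ)⁻¹ * ∑ b, f (x b) - ∫ s, f s ∂(Measure.pi p)‖ₑ) (by fun_prop)

variable [DecidableEq ι]

theorem IsInformationDensity.blockDensity (hi : IsInformationDensity p i) :
    IsInformationDensity (fun ν => Measure.pi fun _ : κ => p ν) (blockDensity i) where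
  measurable T := Finset.measurable_sum _ fun b _ => (hi.measurable T).comp
    (g := Function.uncurry (i T)) (f := fun q : (ι → κ → X) × (κ → Y) =>
      (fun ν => q.1 ν b, q.2 b)) (by fun_prop)
  lintegral_exp_le_one T hT x y := by
    set f : κ → (ι → X) → ℝ≥0∞ := fun b x' =>
      ENNReal.ofReal (Real.exp (i T (T.piecewise x' fun ν => x ν b) (y b)))
    have hf (b : κ) : Measurable (f b) :=
      (Real.measurable_exp.comp ((hi.measurable T).comp (((measurable_piecewise T).comp
        (measurable_id.prodMk measurable_const)).prodMk measurable_const))).ennreal_ofReal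
    have hexp (x' : ι → κ → X) : ENNReal.ofReal (Real.exp
        (NoisyFBMAC.blockDensity i T (T.piecewise x' x) y)) = ∏ b, f b fun ν => x' ν b := by
      rw [NoisyFBMAC.blockDensity, Real.exp_sum,
        ENNReal.ofReal_prod_of_nonneg fun _ _ => Real.exp_nonneg _]
      refine Finset.prod_congr rfl fun b _ => ?_
      congr! with ν
      by_cases hν : ν ∈ T <;> simp [hν]
    calc _ = ∫⁻ x', ∏ b, f b (x' b) ∂(Measure.pi fun _ => Measure.pi p) := by
          simp only [hexp]
          exact (measurePreserving_pi_swap fun ν (_ : κ) => p ν).lintegral_comp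
            (f := fun x' => ∏ b, f b (x' b)) (by fun_prop)
      _ = ∏ b, ∫⁻ x', f b x' ∂(Measure.pi p) := lintegral_pi_prod _ hf
      _ ≤ 1 := Finset.prod_le_one (fun _ _ => zero_le) fun b _ =>
          hi.lintegral_exp_le_one T hT _ _

theorem tendsto_measure_block_thresholdFailure (hh : Measurable (Function.uncurry h))
    (hi : IsInformationDensity p i)
    (hint : ∀ T : Finset ι, T.Nonempty →
      Integrable (fun q => i T q.1 (h q.1 q.2)) ((Measure.pi p).prod P))
    {γ : Finset ι → ℝ}
    (hγ : ∀ T : Finset ι, T.Nonempty → γ T < ∫ q, i T q.1 (h q.1 q.2) ∂((Measure.pi p).prod P)) :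
    Tendsto (fun k : ℕ => ((Measure.pi fun ν => Measure.pi fun _ : Fin k => p ν).prod
      (Measure.pi fun _ : Fin k => P)) {q | (q.1, blockChannel h q.1 q.2) ∈
        thresholdFailure (blockDensity i) fun T => k * γ T}) atTop (𝓝 0) := by
  set μ := (Measure.pi p).prod P
  set f : Finset ι → (ι → X) × Ω → ℝ := fun T q => i T q.1 (h q.1 q.2)
  have hf (T : Finset ι) : Measurable (f T) := (hi.measurable T).comp (measurable_fst.prodMk hh)
  have hlim := tendsto_finsetSum (Finset.univ.filter Finset.Nonempty) fun T hT =>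
    tendsto_measure_pi_sum_lt μ (hf T) (hint T (Finset.mem_filter.1 hT).2)
      (hγ T (Finset.mem_filter.1 hT).2)
  rw [Finset.sum_const_zero] at hlim
  refine tendsto_of_tendsto_of_tendsto_of_le_of_le tendsto_const_nhds hlim (fun _ => zero_le)
    fun k => ?_
  have hfail (T : Finset ι) : MeasurableSet {q : Fin k → (ι → X) × Ω |
      ∑ b, f T (q b) < k * γ T} := measurableSet_lt (by fun_prop) measurable_const
  calc _ ≤ ((Measure.pi fun ν => Measure.pi fun _ : Fin k => p ν).prod
        (Measure.pi fun _ : Fin k => P)) (⋃ T ∈ Finset.univ.filter Finset.Nonempty,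
          (fun q b => (fun ν => q.1 ν b, q.2 b)) ⁻¹' {q | ∑ b, f T (q b) < k * γ T}) :=
        measure_mono fun q hq => by
          obtain ⟨T, hT, hlt⟩ := hq
          exact Set.mem_biUnion (Finset.mem_filter.2 ⟨Finset.mem_univ T, hT⟩) hlt
    _ ≤ _ := measure_biUnion_finset_le _ _
    _ = _ := Finset.sum_congr rfl fun T _ =>
        (measurePreserving_blocks p P).measure_preimage (hfail T).nullMeasurableSet

theorem exists_vanishing_codes (hh : Measurable (Function.uncurry h))
    (hi : IsInformationDensity p i)
    (hint : ∀ T : Finset ι, T.Nonempty →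
      Integrable (fun q => i T q.1 (h q.1 q.2)) ((Measure.pi p).prod P))
    {γ : Finset ι → ℝ}
    (hγ : ∀ T : Finset ι, T.Nonempty → γ T < ∫ q, i T q.1 (h q.1 q.2) ∂((Measure.pi p).prod P))
    {J : Type*} [Fintype J] {f : J → (ι → X) → ℝ} (hf : ∀ j, Measurable (f j))
    (hfi : ∀ j, Integrable (f j) (Measure.pi p)) {k : ℕ → ℕ} (hk : Tendsto k atTop atTop)
    {M : ℕ → ι → ℕ} [∀ n ν, NeZero (M n ν)]
    (hM : ∀ T : Finset ι, T.Nonempty → Tendsto (fun n => ((∏ ν ∈ T, (M n ν - 1) : ℕ) : ℝ≥0∞) *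
      ENNReal.ofReal (Real.exp (-(k n * γ T)))) atTop (𝓝 0))
    (π : ∀ n, Measure (∀ ν, Fin (M n ν))) [∀ n, IsProbabilityMeasure (π n)] :
    ∃ (c : ∀ n ν, Fin (M n ν) → Fin (k n) → X)
      (dec : ∀ n, (Fin (k n) → Y) → ∀ ν, Fin (M n ν)), (∀ n, Measurable (dec n)) ∧
      Tendsto (fun n => ∫⁻ m, ((Measure.pi fun _ => P)
          {ω | dec n (blockChannel h (codeword (c n) m) ω) ≠ m} +
        ∑ j, ‖(k n : ℝ)⁻¹ * ∑ b, f j (fun ν => c n ν (m ν) b) - ∫ s, f j s ∂(Measure.pi p)‖ₑ)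
          ∂(π n)) atTop (𝓝 0) := by
  have hcost (n : ℕ) (j : J) : Measurable fun x : ι → Fin (k n) → X =>
      ‖(k n : ℝ)⁻¹ * ∑ b, f j (fun ν => x ν b) - ∫ s, f j s ∂(Measure.pi p)‖ₑ := by
    have := hf j
    fun_prop
  choose c dec hdec hle using fun n => exists_code_of_isInformationDensity
    (M := fun ν => Fin (M n ν)) (P := Measure.pi fun _ => P) (measurable_blockChannel hh)
    hi.blockDensity (fun T => k n * γ T)
    (Finset.measurable_sum Finset.univ fun j _ => hcost n j) (π n)
  have hlim := (((tendsto_measure_block_thresholdFailure hh hi hint hγ).comp hk).add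
    (tendsto_finsetSum (Finset.univ.filter Finset.Nonempty) fun T hT =>
      hM T (Finset.mem_filter.1 hT).2)).add (tendsto_finsetSum Finset.univ fun j _ =>
        (tendsto_lintegral_block_average_sub (hf j) (hfi j)).comp hk)
  simp only [Finset.sum_const_zero, add_zero] at hlim
  refine ⟨c, dec, hdec, tendsto_of_tendsto_of_tendsto_of_le_of_le tendsto_const_nhds hlim
    (fun _ => zero_le) fun n => (hle n).trans_eq ?_⟩
  simp only [Fintype.card_fin, Function.comp_apply]
  rw [lintegral_finsetSum _ fun j _ => hcost n j]

end BlockCodes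

section SecondMoments

/-- The random vector `ξ` is centred and square-integrable, with covariance matrix `Γ`. -/
structure HasSecondMoments {Ω ι : Type*} [MeasurableSpace Ω] (μ : Measure Ω) (ξ : Ω → ι → ℝ)
    (Γ : Matrix ι ι ℝ) : Prop where
  memLp : ∀ i, MemLp (fun ω => ξ ω i) 2 μ
  mean : ∀ i, ∫ ω, ξ ω i ∂μ = 0
  cov : ∀ i j, ∫ ω, ξ ω i * ξ ω j ∂μ = Γ i j

namespace HasSecondMoments

variable {Ω Ω' ι κ : Type*} [MeasurableSpace Ω] [MeasurableSpace Ω'] {μ : Measure Ω}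
  {μ' : Measure Ω'} {ξ : Ω → ι → ℝ} {Γ : Matrix ι ι ℝ} {ξ' : Ω' → ι → ℝ} {Γ' : Matrix ι ι ℝ}

theorem integrable [IsFiniteMeasure μ] (h : HasSecondMoments μ ξ Γ) (i : ι) :
    Integrable (fun ω => ξ ω i) μ :=
  (h.memLp i).integrable one_le_two

theorem integrable_mul (h : HasSecondMoments μ ξ Γ) (i j : ι) :
    Integrable (fun ω => ξ ω i * ξ ω j) μ :=
  (h.memLp i).integrable_mul (h.memLp j)

theorem comp_measurePreserving (h : HasSecondMoments μ ξ Γ) {f : Ω' → Ω}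
    (hf : MeasurePreserving f μ' μ) : HasSecondMoments μ' (fun ω => ξ (f ω)) Γ := by
  have hmap {g : Ω → ℝ} (hg : AEStronglyMeasurable g μ) : ∫ ω, g (f ω) ∂μ' = ∫ ω, g ω ∂μ := by
    rw [← hf.map_eq] at hg ⊢
    exact (integral_map hf.aemeasurable hg).symm
  refine ⟨fun i => (h.memLp i).comp_measurePreserving hf, fun i => ?_, fun i j => ?_⟩
  · rw [hmap (h.memLp i).aestronglyMeasurable, h.mean]
  · rw [hmap (g := fun ω => ξ ω i * ξ ω j) (h.integrable_mul i j).aestronglyMeasurable, h.cov]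

theorem mulVec [IsFiniteMeasure μ] [Fintype ι] (h : HasSecondMoments μ ξ Γ) (A : Matrix κ ι ℝ) :
    HasSecondMoments μ (fun ω => A *ᵥ ξ ω) (A * Γ * Aᵀ) where
  memLp a := memLp_finsetSum _ fun i _ => (h.memLp i).const_mul _
  mean a := by
    simp only [Matrix.mulVec, dotProduct]
    rw [integral_finsetSum _ fun i _ => (h.integrable i).const_mul _]
    simp [integral_const_mul, h.mean]
  cov a b := by
    have hmul (ω : Ω) : (A *ᵥ ξ ω) a * (A *ᵥ ξ ω) b =
        ∑ j, ∑ i, A a i * A b j * (ξ ω i * ξ ω j) := by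
      simp only [Matrix.mulVec, dotProduct]
      rw [Finset.sum_mul_sum, Finset.sum_comm]
      exact Finset.sum_congr rfl fun _ _ => Finset.sum_congr rfl fun _ _ => by ring
    simp_rw [hmul]
    rw [integral_finsetSum _ fun j _ => integrable_finsetSum _ fun i _ =>
      (h.integrable_mul i j).const_mul _]
    simp_rw [integral_finsetSum _ fun i _ => (h.integrable_mul i _).const_mul _,
      integral_const_mul, h.cov, Matrix.mul_apply, Finset.sum_mul, Matrix.transpose_apply]
    exact Finset.sum_congr rfl fun _ _ => Finset.sum_congr rfl fun _ _ => by ring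

theorem submatrix (h : HasSecondMoments μ ξ Γ) (f : κ → ι) :
    HasSecondMoments μ (fun ω a => ξ ω (f a)) (Γ.submatrix f f) :=
  ⟨fun _ => h.memLp _, fun _ => h.mean _, fun _ _ => h.cov _ _⟩

theorem prod_add [IsProbabilityMeasure μ] [IsProbabilityMeasure μ'] (h : HasSecondMoments μ ξ Γ)
    (h' : HasSecondMoments μ' ξ' Γ') :
    HasSecondMoments (μ.prod μ') (fun ω => ξ ω.1 + ξ' ω.2) (Γ + Γ') := by
  have hfst := h.comp_measurePreserving (measurePreserving_fst (μ := μ) (ν := μ'))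
  have hsnd := h'.comp_measurePreserving (measurePreserving_snd (μ := μ) (ν := μ'))
  have hcross (i j : ι) : ∫ ω : Ω × Ω', ξ ω.1 i * ξ' ω.2 j ∂(μ.prod μ') = 0 :=
    (integral_prod_mul (fun ω => ξ ω i) fun ω => ξ' ω j).trans (by rw [h.mean, zero_mul])
  have hmul (i j : ι) : Integrable (fun ω : Ω × Ω' => ξ ω.1 i * ξ' ω.2 j) (μ.prod μ') :=
    (hfst.memLp i).integrable_mul (hsnd.memLp j)
  refine ⟨fun i => (hfst.memLp i).add (hsnd.memLp i), fun i => ?_, fun i j => ?_⟩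
  · exact (integral_add (hfst.integrable i) (hsnd.integrable i)).trans
      (by rw [hfst.mean, hsnd.mean, add_zero])
  · calc ∫ ω : Ω × Ω', (ξ ω.1 + ξ' ω.2) i * (ξ ω.1 + ξ' ω.2) j ∂(μ.prod μ')
        = ∫ ω : Ω × Ω', (ξ ω.1 i * ξ ω.1 j + ξ' ω.2 i * ξ' ω.2 j) +
            (ξ ω.1 i * ξ' ω.2 j + ξ ω.1 j * ξ' ω.2 i) ∂(μ.prod μ') := by
          congr with ω
          simp only [Pi.add_apply]
          ring
      _ = (Γ i j + Γ' i j) + (0 + 0) := by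
          rw [integral_add (by exact (hfst.integrable_mul i j).add (hsnd.integrable_mul i j))
            (by exact (hmul i j).add (hmul j i)), integral_add (hmul i j) (hmul j i),
            integral_add (hfst.integrable_mul i j) (hsnd.integrable_mul i j), hcross, hcross,
            hfst.cov, hsnd.cov]
      _ = (Γ + Γ') i j := by simp

theorem pi {τ : Type*} [Fintype τ] [DecidableEq τ] [Countable ι] [IsProbabilityMeasure μ]
    (h : HasSecondMoments μ ξ Γ) :
    HasSecondMoments (Measure.pi fun _ : τ => μ) (fun ω (q : ι × τ) => ξ (ω q.2) q.1)
      (Γ ⊗ₖ (1 : Matrix τ τ ℝ)) := by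
  have heval (s : τ) := h.comp_measurePreserving (measurePreserving_eval (fun _ => μ) s)
  refine ⟨fun q => (heval q.2).memLp q.1, fun q => (heval q.2).mean q.1, ?_⟩
  rintro ⟨i, s⟩ ⟨j, t⟩
  by_cases hst : s = t
  · subst hst
    simpa using (heval s).cov i j
  · have hindep : IndepFun (fun ω : τ → Ω => ξ (ω s) i) (fun ω => ξ (ω t) j)
        (Measure.pi fun _ => μ) :=
      ((iIndepFun_pi (X := fun _ : τ => ξ) fun _ => aemeasurable_pi_iff.2 fun i =>
        (h.memLp i).aestronglyMeasurable.aemeasurable).indepFun hst).comp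
          (measurable_pi_apply i) (measurable_pi_apply j)
    refine (hindep.integral_fun_mul_eq_mul_integral ((heval s).memLp i).aestronglyMeasurable
      ((heval t).memLp j).aestronglyMeasurable).trans ?_
    rw [(heval s).mean, zero_mul, Matrix.kroneckerMap_apply, Matrix.one_apply_ne hst, mul_zero]

theorem integral_const_add_sq [IsProbabilityMeasure μ] (h : HasSecondMoments μ ξ Γ) (d : ℝ)
    (i : ι) : ∫ ω, (d + ξ ω i) ^ 2 ∂μ = d ^ 2 + Γ i i := by
  have hlin : Integrable (fun ω => 2 * d * ξ ω i) μ := (h.integrable i).const_mul _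
  calc ∫ ω, (d + ξ ω i) ^ 2 ∂μ = ∫ ω, d ^ 2 + (2 * d * ξ ω i + ξ ω i * ξ ω i) ∂μ := by
        congr with ω
        ring
    _ = d ^ 2 + Γ i i := by
        rw [integral_add (integrable_const _) (by exact hlin.add (h.integrable_mul i i)),
          integral_add hlin (h.integrable_mul i i), integral_const_mul, h.mean, h.cov]
        simp

section RandomShift

variable {A : Type*} [MeasurableSpace A] {π : Measure A} [IsProbabilityMeasure π]
  [IsProbabilityMeasure μ] {d : A → ℝ}

theorem memLp_prod_add (h : HasSecondMoments μ ξ Γ) (hd : MemLp d 2 π) (i : ι) :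
    MemLp (fun q : A × Ω => d q.1 + ξ q.2 i) 2 (π.prod μ) :=
  (hd.comp_measurePreserving measurePreserving_fst).add
    ((h.memLp i).comp_measurePreserving measurePreserving_snd)

theorem integral_prod_add_sq (h : HasSecondMoments μ ξ Γ) (hd : MemLp d 2 π) (i : ι) :
    ∫ q, (d q.1 + ξ q.2 i) ^ 2 ∂(π.prod μ) = ∫ m, d m ^ 2 ∂π + Γ i i := by
  rw [integral_prod _ (h.memLp_prod_add hd i).integrable_sq]
  simp only [h.integral_const_add_sq]
  rw [integral_add hd.integrable_sq (integrable_const _)]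
  simp

end RandomShift

variable [Fintype ι]

theorem integrable_dotProduct_mulVec (h : HasSecondMoments μ ξ Γ) (A : Matrix ι ι ℝ) :
    Integrable (fun ω => ξ ω ⬝ᵥ A *ᵥ ξ ω) μ := by
  refine integrable_finsetSum _ fun i _ => ?_
  simp only [Matrix.mulVec, dotProduct, Finset.mul_sum, mul_left_comm _ (A i _)]
  exact integrable_finsetSum _ fun j _ => (h.integrable_mul i j).const_mul _

theorem integral_dotProduct_mulVec (h : HasSecondMoments μ ξ Γ) (A : Matrix ι ι ℝ) :
    ∫ ω, ξ ω ⬝ᵥ A *ᵥ ξ ω ∂μ = (A * Γ).trace := by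
  have hint (i j : ι) : Integrable (fun ω => A i j * (ξ ω j * ξ ω i)) μ :=
    (h.integrable_mul j i).const_mul _
  calc ∫ ω, ξ ω ⬝ᵥ A *ᵥ ξ ω ∂μ = ∫ ω, ∑ i, ∑ j, A i j * (ξ ω j * ξ ω i) ∂μ := by
        congr with ω
        simp only [Matrix.mulVec, dotProduct, Finset.mul_sum]
        exact Finset.sum_congr rfl fun i _ => Finset.sum_congr rfl fun j _ => by ring
    _ = ∑ i, ∑ j, A i j * Γ j i := by
        rw [integral_finsetSum _ fun i _ => integrable_finsetSum _ fun j _ => hint i j]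
        simp_rw [integral_finsetSum _ fun j _ => hint _ j, integral_const_mul, h.cov]
    _ = (A * Γ).trace := rfl

end HasSecondMoments

theorem hasSecondMoments_gaussianReal {N : ℝ} (hN : 0 ≤ N) :
    HasSecondMoments (gaussianReal 0 N.toNNReal) (fun x (_ : Unit) => x) (N • 1) where
  memLp _ := memLp_id_gaussianReal 2
  mean _ := integral_id_gaussianReal
  cov _ _ := by
    have := variance_id_gaussianReal (μ := 0) (v := N.toNNReal)
    rw [variance_eq_integral (by fun_prop)] at this
    simpa [hN, sq] using this

theorem hasSecondMoments_pi_gaussianReal {ι : Type*} [Fintype ι] [DecidableEq ι] {N : ℝ}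
    (hN : 0 ≤ N) :
    HasSecondMoments (Measure.pi fun _ : ι => gaussianReal 0 N.toNNReal) (fun x => x) (N • 1) := by
  have h := (hasSecondMoments_gaussianReal hN).pi (τ := ι).submatrix fun i => ((), i)
  convert h using 1
  ext i j
  simp [Matrix.one_apply]

theorem hasSecondMoments_multivariateGaussian {ι : Type*} [Fintype ι] [DecidableEq ι]
    {S : Matrix ι ι ℝ} (hS : S.PosSemidef) :
    HasSecondMoments (multivariateGaussian 0 S) (fun (x : EuclideanSpace ℝ ι) i => x i) S := by
  have hmem (i : ι) : MemLp (fun x : EuclideanSpace ℝ ι => x i) 2 (multivariateGaussian 0 S) :=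
    (EuclideanSpace.proj (𝕜 := ℝ) i).comp_memLp' IsGaussian.memLp_two_id
  have hmean (i : ι) : ∫ x : EuclideanSpace ℝ ι, x i ∂(multivariateGaussian 0 S) = 0 := by
    have := (EuclideanSpace.proj (𝕜 := ℝ) i).integral_comp_comm
      (IsGaussian.integrable_id (μ := multivariateGaussian (0 : EuclideanSpace ℝ ι) S))
    simpa using this
  refine ⟨hmem, hmean, fun i j => ?_⟩
  rw [← covariance_eval_multivariateGaussian (μ := 0) hS, covariance_eq_sub (hmem i) (hmem j),
    hmean, hmean]
  simp

end SecondMoments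

section GaussianInformationDensity

theorem lintegral_exp_quadratic_gaussianReal (c : ℝ) {β : ℝ} (hβ : 0 < 1 + β) :
    ∫⁻ x, ENNReal.ofReal (Real.exp (c * x - β * x ^ 2 / 2)) ∂(gaussianReal 0 1) =
      ENNReal.ofReal (Real.exp ((c ^ 2 / (1 + β) - Real.log (1 + β)) / 2)) := by
  set v : NNReal := (1 + β)⁻¹.toNNReal
  have hv : (v : ℝ) = (1 + β)⁻¹ := Real.coe_toNNReal _ (inv_pos.2 hβ).le
  have hv0 : v ≠ 0 := by simpa [v] using hβ
  have hsqrt : √(1 + β) = Real.exp (Real.log (1 + β) / 2) := by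
    rw [Real.exp_half, Real.exp_log hβ]
  have hpdf (x : ℝ) : gaussianPDFReal 0 1 x * Real.exp (c * x - β * x ^ 2 / 2) =
      Real.exp ((c ^ 2 / (1 + β) - Real.log (1 + β)) / 2) *
        gaussianPDFReal (c / (1 + β)) v x := by
    have hexp : -(x - 0) ^ 2 / (2 * 1) + (c * x - β * x ^ 2 / 2) =
        (c ^ 2 / (1 + β) - Real.log (1 + β)) / 2 + (Real.log (1 + β) / 2 +
          -(x - c / (1 + β)) ^ 2 / (2 * (1 + β)⁻¹)) := by
      field_simp
      ring
    rw [gaussianPDFReal, gaussianPDFReal, hv, NNReal.coe_one, mul_assoc, ← Real.exp_add, hexp,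
      Real.exp_add, Real.exp_add, ← hsqrt, Real.sqrt_mul (by positivity) (1 + β)⁻¹, Real.sqrt_inv,
      mul_one]
    field_simp
  rw [gaussianReal_of_var_ne_zero _ one_ne_zero,
    lintegral_withDensity_eq_lintegral_mul _ (measurable_gaussianPDF _ _) (by fun_prop)]
  simp_rw [Pi.mul_apply, gaussianPDF, ← ENNReal.ofReal_mul (gaussianPDFReal_nonneg _ _ _), hpdf,
    ENNReal.ofReal_mul (Real.exp_nonneg _)]
  rw [lintegral_const_mul _ (measurable_gaussianPDFReal _ _).ennreal_ofReal]
  exact (congrArg _ (lintegral_gaussianPDF_eq_one _ hv0)).trans (mul_one _)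

theorem lintegral_pi_update {ι : Type*} [Fintype ι] [DecidableEq ι] {X : ι → Type*}
    [∀ ν, MeasurableSpace (X ν)] (μ : ∀ ν, Measure (X ν)) [∀ ν, IsProbabilityMeasure (μ ν)]
    {F : (∀ ν, X ν) → ℝ≥0∞} (hF : Measurable F) (ν : ι) :
    ∫⁻ x, ∫⁻ t, F (Function.update x ν t) ∂(μ ν) ∂(Measure.pi μ) = ∫⁻ x, F x ∂(Measure.pi μ) := by
  have hmarginal : (fun x => ∫⁻ t, F (Function.update x ν t) ∂(μ ν)) = ∫⋯∫⁻_{ν}, F ∂μ :=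
    (lmarginal_singleton F ν).symm
  rw [hmarginal]
  refine lintegral_eq_of_lmarginal_eq {ν} (hF.lmarginal μ) hF ?_
  ext x
  rw [lmarginal_singleton]
  simp_rw [lmarginal_update_of_mem μ (Finset.mem_singleton_self ν)]
  simp

variable {m ι Ω : Type*} [MeasurableSpace Ω]

section RankOneUpdate

variable {K : Type*} [Field K] [Fintype m] [DecidableEq m] {S : Matrix m m K}

theorem det_add_vecMulVec (hS : IsUnit S.det) (u v : m → K) :
    (S + Matrix.vecMulVec u v).det = S.det * (1 + v ⬝ᵥ S⁻¹ *ᵥ u) := by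
  rw [Matrix.vecMulVec_eq Unit, Matrix.det_add_replicateCol_mul_replicateRow hS,
    Matrix.det_unique (n := Unit), Matrix.mul_assoc, ← Matrix.replicateCol_mulVec]
  simp [Matrix.mul_apply, dotProduct]

theorem inv_add_vecMulVec_mulVec (hS : IsUnit S.det) {u v : m → K}
    (huv : 1 + v ⬝ᵥ S⁻¹ *ᵥ u ≠ 0) (w : m → K) :
    (S + Matrix.vecMulVec u v)⁻¹ *ᵥ w =
      S⁻¹ *ᵥ w - (v ⬝ᵥ S⁻¹ *ᵥ w / (1 + v ⬝ᵥ S⁻¹ *ᵥ u)) • S⁻¹ *ᵥ u := by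
  have hdet : IsUnit (S + Matrix.vecMulVec u v).det := by
    rw [det_add_vecMulVec hS]
    exact hS.mul (isUnit_iff_ne_zero.2 huv)
  have hcancel (x : m → K) : S *ᵥ S⁻¹ *ᵥ x = x := by
    rw [Matrix.mulVec_mulVec, Matrix.mul_nonsing_inv _ hS, Matrix.one_mulVec]
  obtain ⟨_⟩ := ((Matrix.isUnit_iff_isUnit_det _).2 hdet).nonempty_invertible
  refine Matrix.inv_mulVec_eq_vec ?_
  ext i
  simp only [Matrix.add_mulVec, Matrix.mulVec_sub, Matrix.mulVec_smul, hcancel,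
    Matrix.vecMulVec_mulVec, Pi.add_apply, Pi.sub_apply, Pi.smul_apply, smul_eq_mul,
    MulOpposite.smul_eq_mul_unop, MulOpposite.unop_op]
  field_simp
  ring

end RankOneUpdate

variable {S : Matrix m m ℝ}

theorem posDef_add_sum_vecMulVec [Finite m] (hS : S.PosDef) (b : ι → m → ℝ) (T : Finset ι) :
    (S + ∑ ν ∈ T, Matrix.vecMulVec (b ν) (b ν)).PosDef :=
  hS.add_posSemidef <| Matrix.posSemidef_sum T fun ν _ =>
    Matrix.posSemidef_vecMulVec_self_star (b ν)

theorem HasSecondMoments.sum_smul_add [Fintype ι] {P : Measure Ω} {U : Ω → m → ℝ}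
    [IsProbabilityMeasure P] (hU : HasSecondMoments P U S)
    (b : ι → m → ℝ) (T : Finset ι) :
    HasSecondMoments ((Measure.pi fun _ : ι => gaussianReal 0 1).prod P)
      (fun q => ∑ ν ∈ T, q.1 ν • b ν + U q.2)
      (S + ∑ ν ∈ T, Matrix.vecMulVec (b ν) (b ν)) := by
  classical
  set A : Matrix m ι ℝ := Matrix.of fun i ν => if ν ∈ T then b ν i else 0 with hA
  have hx := (hasSecondMoments_pi_gaussianReal (ι := ι) zero_le_one).mulVec A
  rw [Real.toNNReal_one] at hx
  have hmulVec (x : ι → ℝ) : A *ᵥ x = ∑ ν ∈ T, x ν • b ν := by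
    ext i
    simp [hA, Matrix.mulVec, dotProduct, Finset.sum_apply, mul_comm, Finset.sum_ite_mem]
  have hcov : A * ((1 : ℝ) • (1 : Matrix ι ι ℝ)) * Aᵀ = ∑ ν ∈ T, Matrix.vecMulVec (b ν) (b ν) := by
    ext i j
    simp [hA, Matrix.mul_apply, Matrix.sum_apply, Matrix.vecMulVec_apply, Finset.sum_ite_mem]
  simpa only [hmulVec, hcov, add_comm S] using hx.prod_add hU

variable [Fintype m] [DecidableEq m]

/-- The logarithm of the centred Gaussian density of covariance matrix `S`, without the summand
`-(card m / 2) log (2π)`: it cancels in every information density. -/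
noncomputable def logGaussian (S : Matrix m m ℝ) (w : m → ℝ) : ℝ :=
  -(Real.log S.det + w ⬝ᵥ S⁻¹ *ᵥ w) / 2

theorem continuous_logGaussian (S : Matrix m m ℝ) : Continuous (logGaussian S) := by
  unfold logGaussian
  fun_prop

theorem lintegral_exp_logGaussian_sub_smul (hS : S.PosDef) (b w : m → ℝ) :
    ∫⁻ x, ENNReal.ofReal (Real.exp (logGaussian S (w - x • b))) ∂(gaussianReal 0 1) =
      ENNReal.ofReal (Real.exp (logGaussian (S + Matrix.vecMulVec b b) w)) := by
  have hdet : IsUnit S.det := hS.det_pos.ne'.isUnit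
  set β := b ⬝ᵥ S⁻¹ *ᵥ b with hβ
  set c := b ⬝ᵥ S⁻¹ *ᵥ w with hc
  have hβ0 : 0 < 1 + β := by
    have : 0 ≤ β := hS.inv.posSemidef.dotProduct_mulVec_nonneg b
    positivity
  have hsymm : w ⬝ᵥ S⁻¹ *ᵥ b = c := by
    rw [hc, Matrix.dotProduct_mulVec, ← Matrix.mulVec_transpose, dotProduct_comm,
      show S⁻¹ᵀ = S⁻¹ from hS.isHermitian.inv]
  have hshift (x : ℝ) : logGaussian S (w - x • b) =
      logGaussian S w + (c * x - β * x ^ 2 / 2) := by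
    simp only [logGaussian, Matrix.mulVec_sub, Matrix.mulVec_smul, sub_dotProduct, dotProduct_sub,
      smul_dotProduct, dotProduct_smul, smul_eq_mul, hsymm, ← hc, ← hβ]
    ring
  have hupdate : logGaussian (S + Matrix.vecMulVec b b) w =
      logGaussian S w + (c ^ 2 / (1 + β) - Real.log (1 + β)) / 2 := by
    rw [logGaussian, logGaussian, det_add_vecMulVec hdet, inv_add_vecMulVec_mulVec hdet hβ0.ne',
      Real.log_mul hdet.ne_zero hβ0.ne', dotProduct_sub, dotProduct_smul, hsymm, smul_eq_mul]
    ring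
  simp_rw [hshift, Real.exp_add, ENNReal.ofReal_mul (Real.exp_nonneg _)]
  rw [lintegral_const_mul _ (by fun_prop), lintegral_exp_quadratic_gaussianReal c hβ0, hupdate,
    Real.exp_add, ENNReal.ofReal_mul (Real.exp_nonneg _)]

variable [Fintype ι]

theorem lintegral_exp_logGaussian_sub_sum (hS : S.PosDef) (b : ι → m → ℝ) (T : Finset ι)
    (w : m → ℝ) :
    ∫⁻ x, ENNReal.ofReal (Real.exp (logGaussian S (w - ∑ ν ∈ T, x ν • b ν)))
        ∂(Measure.pi fun _ => gaussianReal 0 1) =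
      ENNReal.ofReal (Real.exp (logGaussian (S + ∑ ν ∈ T, Matrix.vecMulVec (b ν) (b ν)) w)) := by
  classical
  induction T using Finset.induction_on generalizing S with
  | empty => simp
  | insert ν T hν ih =>
    have hsum (x : ι → ℝ) (t : ℝ) : ∑ μ ∈ insert ν T, Function.update x ν t μ • b μ =
        ∑ μ ∈ T, x μ • b μ + t • b ν := by
      rw [Finset.sum_insert hν, Function.update_self, add_comm]
      congr 1
      refine Finset.sum_congr rfl fun μ hμ => ?_
      rw [Function.update_of_ne (ne_of_mem_of_not_mem hμ hν)]
    rw [← lintegral_pi_update _ ?_ ν]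
    · simp_rw [hsum, ← sub_sub, lintegral_exp_logGaussian_sub_smul hS]
      rw [ih, Finset.sum_insert hν, add_assoc]
      simpa using posDef_add_sum_vecMulVec hS b {ν}
    · exact ((continuous_logGaussian S).comp (by fun_prop)).rexp.measurable.ennreal_ofReal

variable [DecidableEq ι]

/-- The information density of the additive Gaussian multiple-access channel
`w = ∑ ν, x ν • b ν + U`, `U` of covariance matrix `S`, for independent standard normal inputs:
the logarithm of the density of `w` given all inputs over that given the inputs outside `T`. -/
noncomputable def gaussianDensity (b : ι → m → ℝ) (S : Matrix m m ℝ) (T : Finset ι) (x : ι → ℝ)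
    (w : m → ℝ) : ℝ :=
  logGaussian S (w - ∑ ν, x ν • b ν) -
    logGaussian (S + ∑ ν ∈ T, Matrix.vecMulVec (b ν) (b ν)) (w - ∑ ν ∈ Tᶜ, x ν • b ν)

theorem gaussianDensity_sum_smul_add (b : ι → m → ℝ) (S : Matrix m m ℝ) (T : Finset ι) (x : ι → ℝ)
    (u : m → ℝ) :
    gaussianDensity b S T x (∑ ν, x ν • b ν + u) =
      logGaussian S u -
        logGaussian (S + ∑ ν ∈ T, Matrix.vecMulVec (b ν) (b ν)) (∑ ν ∈ T, x ν • b ν + u) := by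
  rw [gaussianDensity, add_sub_cancel_left, ← Finset.sum_add_sum_compl T, add_right_comm,
    add_sub_cancel_right]

theorem isInformationDensity_gaussianDensity (hS : S.PosDef) (b : ι → m → ℝ) :
    IsInformationDensity (fun _ => gaussianReal 0 1) (gaussianDensity b S) where
  measurable T := (((continuous_logGaussian _).comp (by fun_prop)).sub
    ((continuous_logGaussian _).comp (by fun_prop))).measurable
  lintegral_exp_le_one T _ x w := by
    have hin (x' : ι → ℝ) : ∑ ν, T.piecewise x' x ν • b ν =
        ∑ ν ∈ Tᶜ, x ν • b ν + ∑ ν ∈ T, x' ν • b ν := by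
      rw [← Finset.sum_add_sum_compl T, add_comm]
      congr 1
      · exact Finset.sum_congr rfl fun ν hν => by
          rw [Finset.piecewise_eq_of_notMem _ _ _ (Finset.mem_compl.1 hν)]
      · exact Finset.sum_congr rfl fun ν hν => by rw [Finset.piecewise_eq_of_mem _ _ _ hν]
    have hout (x' : ι → ℝ) : ∑ ν ∈ Tᶜ, T.piecewise x' x ν • b ν = ∑ ν ∈ Tᶜ, x ν • b ν :=
      Finset.sum_congr rfl fun ν hν => by
        rw [Finset.piecewise_eq_of_notMem _ _ _ (Finset.mem_compl.1 hν)]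
    simp_rw [gaussianDensity, hin, hout, ← sub_sub, Real.exp_sub,
      div_eq_mul_inv, ENNReal.ofReal_mul (Real.exp_nonneg _)]
    rw [lintegral_mul_const _ ?_, lintegral_exp_logGaussian_sub_sum hS,
      ← ENNReal.ofReal_mul (Real.exp_nonneg _), mul_inv_cancel₀ (Real.exp_ne_zero _),
      ENNReal.ofReal_one]
    exact ((continuous_logGaussian S).comp (by fun_prop)).rexp.measurable.ennreal_ofReal

namespace HasSecondMoments

variable {P : Measure Ω} {U : Ω → m → ℝ}

theorem integrable_logGaussian [IsFiniteMeasure P] (hU : HasSecondMoments P U S)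
    (R : Matrix m m ℝ) : Integrable (fun ω => logGaussian R (U ω)) P :=
  (((integrable_const _).add (hU.integrable_dotProduct_mulVec _)).neg).div_const 2

theorem integral_logGaussian [IsProbabilityMeasure P] (hU : HasSecondMoments P U S)
    (hS : IsUnit S.det) :
    ∫ ω, logGaussian S (U ω) ∂P = -(Real.log S.det + Fintype.card m) / 2 := by
  simp only [logGaussian]
  rw [integral_div, integral_neg, integral_add (integrable_const _)
    (hU.integrable_dotProduct_mulVec _), hU.integral_dotProduct_mulVec,
    Matrix.nonsing_inv_mul _ hS, Matrix.trace_one]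
  simp

variable [IsProbabilityMeasure P]

theorem integrable_gaussianDensity (hU : HasSecondMoments P U S) (b : ι → m → ℝ) (T : Finset ι) :
    Integrable (fun q => gaussianDensity b S T q.1 (∑ ν, q.1 ν • b ν + U q.2))
      ((Measure.pi fun _ => gaussianReal 0 1).prod P) := by
  simp_rw [gaussianDensity_sum_smul_add]
  exact ((hU.comp_measurePreserving measurePreserving_snd).integrable_logGaussian S).sub
    ((hU.sum_smul_add b T).integrable_logGaussian _)

theorem integral_gaussianDensity (hU : HasSecondMoments P U S) (hS : S.PosDef) (b : ι → m → ℝ)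
    (T : Finset ι) :
    ∫ q, gaussianDensity b S T q.1 (∑ ν, q.1 ν • b ν + U q.2)
        ∂((Measure.pi fun _ => gaussianReal 0 1).prod P) =
      1 / 2 * Real.log ((S + ∑ ν ∈ T, Matrix.vecMulVec (b ν) (b ν)).det / S.det) := by
  have hU₂ := hU.comp_measurePreserving
    (measurePreserving_snd (μ := Measure.pi fun _ : ι => gaussianReal 0 1) (ν := P))
  have hT := (posDef_add_sum_vecMulVec hS b T).det_pos.ne'
  simp_rw [gaussianDensity_sum_smul_add]
  rw [integral_sub (hU₂.integrable_logGaussian S) ((hU.sum_smul_add b T).integrable_logGaussian _),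
    hU₂.integral_logGaussian hS.det_pos.ne'.isUnit,
    (hU.sum_smul_add b T).integral_logGaussian hT.isUnit, Real.log_div hT hS.det_pos.ne']
  ring

end HasSecondMoments

end GaussianInformationDensity

section BlockMatrices

variable {η : ℕ} (a : Fin 2 → Fin η → ℝ) (B : Fin 2 → Matrix (Fin η) (Fin η) ℝ)

theorem vecCons_apply_zero_one {α : Type*} (f : Fin 2 → α) (ν : Fin 2) : ![f 0, f 1] ν = f ν := by
  fin_cases ν <;> rfl

theorem Ab_apply (i : Fin η) (ν : Fin 2) : Ab (a 0) (a 1) i ν = a ν i :=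
  congrFun (vecCons_apply_zero_one a ν) i

theorem Ad_apply (p : Fin 2 × Fin η) (μ : Fin 2) :
    Ad (a 0) (a 1) p μ = if p.1 = μ then a p.1 p.2 else 0 := by
  rw [Ad, Matrix.of_apply, vecCons_apply_zero_one]

theorem Bb_apply (i : Fin η) (q : Fin 2 × Fin η) : Bb (B 0) (B 1) i q = B q.1 i q.2 := by
  rw [Bb, Matrix.of_apply, vecCons_apply_zero_one]

theorem Bt_apply (p : Fin 2 × Fin η) (j : Fin η) : Bt (B 0) (B 1) p j = B p.1 p.2 j := by
  rw [Bt, Matrix.of_apply, vecCons_apply_zero_one]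

theorem Bd_apply (p q : Fin 2 × Fin η) :
    Bd (B 0) (B 1) p q = if p.1 = q.1 then B p.1 p.2 q.2 else 0 := by
  rw [Bd, Matrix.of_apply, vecCons_apply_zero_one]

theorem BB_apply (p q : Fin 2 × Fin η) : BB (B 0) (B 1) p q = B p.1 p.2 q.2 := by
  rw [BB, Matrix.of_apply, vecCons_apply_zero_one]

end BlockMatrices

section BlockNoise

variable {η : ℕ} {N : ℝ} {KW : Matrix (Fin 2) (Fin 2) ℝ}

instance isProbabilityMeasure_noiseLaw : IsProbabilityMeasure (noiseLaw N KW) := by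
  unfold noiseLaw
  infer_instance

/-- The linear function of the noise in a block of `η` channel uses that has coefficients `L` in
the channel noise `(Z_t)` and `K` in the feedback noise `(W_{ν,t})`. -/
def linearNoise {κ : Type*} (L : Matrix κ (Fin η) ℝ) (K : Matrix κ (Fin 2 × Fin η) ℝ)
    (z : Fin η → ℝ × EuclideanSpace ℝ (Fin 2)) : κ → ℝ :=
  (L *ᵥ fun i => (z i).1) + K *ᵥ fun q => (z q.2).2 q.1

theorem measurable_linearNoise {κ : Type*} (L : Matrix κ (Fin η) ℝ)
    (K : Matrix κ (Fin 2 × Fin η) ℝ) : Measurable (linearNoise L K) := by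
  unfold linearNoise Matrix.mulVec dotProduct
  fun_prop

theorem hasSecondMoments_linearNoise {κ : Type*} (hN : 0 ≤ N) (hKW : KW.PosSemidef)
    (L : Matrix κ (Fin η) ℝ) (K : Matrix κ (Fin 2 × Fin η) ℝ) :
    HasSecondMoments (Measure.pi fun _ : Fin η => noiseLaw N KW) (linearNoise L K)
      (N • (L * Lᵀ) + K * (KW ⊗ₖ (1 : Matrix (Fin η) (Fin η) ℝ)) * Kᵀ) := by
  have hZ := (hasSecondMoments_pi_gaussianReal (ι := Fin η) hN).mulVec L
  have hW := ((hasSecondMoments_multivariateGaussian hKW).pi (τ := Fin η)).mulVec K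
  have h := (hZ.prod_add hW).comp_measurePreserving
    (measurePreserving_arrowProdEquivProdArrow ℝ (EuclideanSpace ℝ (Fin 2)) (Fin η)
      (fun _ => gaussianReal 0 N.toNNReal) fun _ => multivariateGaussian 0 KW)
  simp only [Matrix.mul_smul, Matrix.mul_one, Matrix.smul_mul] at h
  exact h

/-- The noise `U` that is left in the outputs `Y` of a block after removal of the fed-back outputs:
`Y - (B 0 + B 1) Y` is the sum of the signal and of `U`. -/
def residualNoise (B : Fin 2 → Matrix (Fin η) (Fin η) ℝ) :
    (Fin η → ℝ × EuclideanSpace ℝ (Fin 2)) → Fin η → ℝ :=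
  linearNoise 1 (Bb (B 0) (B 1))

/-- The contribution of the noise to the channel inputs in a block. -/
noncomputable def inputNoise (B : Fin 2 → Matrix (Fin η) (Fin η) ℝ)
    (z : Fin η → ℝ × EuclideanSpace ℝ (Fin 2)) : Fin 2 × Fin η → ℝ :=
  (1 - BB (B 0) (B 1))⁻¹ *ᵥ linearNoise (Bt (B 0) (B 1)) (Bd (B 0) (B 1)) z

/-- The contribution of the code symbols `x` to the channel inputs in a block. -/
noncomputable def inputSignal (a : Fin 2 → Fin η → ℝ) (B : Fin 2 → Matrix (Fin η) (Fin η) ℝ)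
    (x : Fin 2 → ℝ) : Fin 2 × Fin η → ℝ :=
  ((1 - BB (B 0) (B 1))⁻¹ * Ad (a 0) (a 1)) *ᵥ x

/-- The energy that the noise contributes on average to the inputs of Transmitter `ν` in a block. -/
noncomputable def noisePower (N : ℝ) (KW : Matrix (Fin 2) (Fin 2) ℝ)
    (B : Fin 2 → Matrix (Fin η) (Fin η) ℝ) (ν : Fin 2) : ℝ :=
  (diagBlock ((1 - BB (B 0) (B 1))⁻¹ * (N • (Bt (B 0) (B 1) * (Bt (B 0) (B 1))ᵀ) +
    Bd (B 0) (B 1) * (KW ⊗ₖ (1 : Matrix (Fin η) (Fin η) ℝ)) * (Bd (B 0) (B 1))ᵀ) *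
    ((1 - BB (B 0) (B 1))⁻¹)ᵀ) ν).trace

/-- The energy that standard code symbols contribute on average to the inputs of Transmitter `ν` in
a block. -/
noncomputable def signalPower (a : Fin 2 → Fin η → ℝ) (B : Fin 2 → Matrix (Fin η) (Fin η) ℝ)
    (ν : Fin 2) : ℝ :=
  (diagBlock ((1 - BB (B 0) (B 1))⁻¹ * Ad (a 0) (a 1) *
    ((1 - BB (B 0) (B 1))⁻¹ * Ad (a 0) (a 1))ᵀ) ν).trace

/-- The energy that the code symbols `x` contribute to the inputs of Transmitter `ν` in a block. -/
noncomputable def signalEnergy (a : Fin 2 → Fin η → ℝ) (B : Fin 2 → Matrix (Fin η) (Fin η) ℝ)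
    (ν : Fin 2) (x : Fin 2 → ℝ) : ℝ :=
  ∑ i, inputSignal a B x (ν, i) ^ 2

variable (a : Fin 2 → Fin η → ℝ) (B : Fin 2 → Matrix (Fin η) (Fin η) ℝ) (ν : Fin 2)

theorem measurable_residualNoise : Measurable (residualNoise B) :=
  measurable_linearNoise _ _

theorem hasSecondMoments_residualNoise (hN : 0 ≤ N) (hKW : KW.PosSemidef) :
    HasSecondMoments (Measure.pi fun _ : Fin η => noiseLaw N KW) (residualNoise B)
      (noiseCov N KW (B 0) (B 1)) := by
  simpa [residualNoise, noiseCov] using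
    hasSecondMoments_linearNoise hN hKW (1 : Matrix (Fin η) (Fin η) ℝ) (Bb (B 0) (B 1))

theorem hasSecondMoments_inputNoise (hN : 0 ≤ N) (hKW : KW.PosSemidef) :
    HasSecondMoments (Measure.pi fun _ : Fin η => noiseLaw N KW) (inputNoise B)
      ((1 - BB (B 0) (B 1))⁻¹ * (N • (Bt (B 0) (B 1) * (Bt (B 0) (B 1))ᵀ) +
        Bd (B 0) (B 1) * (KW ⊗ₖ (1 : Matrix (Fin η) (Fin η) ℝ)) * (Bd (B 0) (B 1))ᵀ) *
        ((1 - BB (B 0) (B 1))⁻¹)ᵀ) :=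
  (hasSecondMoments_linearNoise hN hKW _ _).mulVec _

theorem hasSecondMoments_inputSignal :
    HasSecondMoments (Measure.pi fun _ : Fin 2 => gaussianReal 0 1) (inputSignal a B)
      ((1 - BB (B 0) (B 1))⁻¹ * Ad (a 0) (a 1) *
        ((1 - BB (B 0) (B 1))⁻¹ * Ad (a 0) (a 1))ᵀ) := by
  have h := (hasSecondMoments_pi_gaussianReal (ι := Fin 2) zero_le_one).mulVec
    ((1 - BB (B 0) (B 1))⁻¹ * Ad (a 0) (a 1))
  simp only [Real.toNNReal_one, one_smul, Matrix.mul_one] at h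
  exact h

theorem trace_diagBlock_inputCov :
    (diagBlock (inputCov N KW (a 0) (a 1) (B 0) (B 1)) ν).trace =
      signalPower a B ν + noisePower N KW B ν := by
  rw [signalPower, noisePower, inputCov, ← Matrix.trace_add, add_assoc, Matrix.mul_add,
    Matrix.add_mul, Matrix.transpose_mul, ← Matrix.mul_assoc, Matrix.mul_assoc _ _ᵀ,
    ← Matrix.mul_assoc]
  rfl

theorem signalPower_eq_sum_sq : signalPower a B ν =
    ∑ i : Fin η, ∑ μ, ((1 - BB (B 0) (B 1))⁻¹ * Ad (a 0) (a 1)) (ν, i) μ ^ 2 := by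
  simp only [sq]
  rfl

theorem signalPower_nonneg : 0 ≤ signalPower a B ν := by
  rw [signalPower_eq_sum_sq]
  positivity

theorem signalPower_smul (s : ℝ) : signalPower (s • a) B ν = s ^ 2 * signalPower a B ν := by
  have hAd : Ad (s • a 0) (s • a 1) = s • Ad (a 0) (a 1) := by
    ext p μ
    exact (Ad_apply (s • a) p μ).trans (by simp [Ad_apply])
  simp only [signalPower_eq_sum_sq, Pi.smul_apply, hAd, Matrix.mul_smul, Matrix.smul_apply,
    smul_eq_mul, mul_pow, Finset.mul_sum]

variable {a B ν} in
theorem signalEnergy_eq_zero (h : signalPower a B ν = 0) (x : Fin 2 → ℝ) :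
    signalEnergy a B ν x = 0 := by
  rw [signalPower_eq_sum_sq,
    Fintype.sum_eq_zero_iff_of_nonneg fun i => Finset.sum_nonneg fun _ _ => sq_nonneg _] at h
  have hrow (i : Fin η) (μ : Fin 2) : ((1 - BB (B 0) (B 1))⁻¹ * Ad (a 0) (a 1)) (ν, i) μ = 0 :=
    pow_eq_zero_iff two_ne_zero |>.1 <| congrFun
      ((Fintype.sum_eq_zero_iff_of_nonneg fun _ => sq_nonneg _).1 (congrFun h i)) μ
  simp [signalEnergy, inputSignal, Matrix.mulVec, dotProduct, hrow]

theorem measurable_signalEnergy : Measurable (signalEnergy a B ν) := by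
  unfold signalEnergy inputSignal Matrix.mulVec dotProduct
  fun_prop

theorem integrable_signalEnergy :
    Integrable (signalEnergy a B ν) (Measure.pi fun _ => gaussianReal 0 1) :=
  integrable_finsetSum _ fun i _ => ((hasSecondMoments_inputSignal a B).memLp (ν, i)).integrable_sq

theorem integral_signalEnergy :
    ∫ x, signalEnergy a B ν x ∂(Measure.pi fun _ => gaussianReal 0 1) = signalPower a B ν := by
  unfold signalEnergy
  rw [integral_finsetSum _ fun i _ =>
    ((hasSecondMoments_inputSignal a B).memLp (ν, i)).integrable_sq]
  simp only [sq, (hasSecondMoments_inputSignal a B).cov]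
  rfl

variable {B}

theorem isUnit_one_sub_BB (hB : ∀ ν, StrictlyLower (B ν)) : IsUnit (1 - BB (B 0) (B 1)) := by
  rw [← Matrix.mulVec_injective_iff_isUnit]
  refine (injective_iff_map_eq_zero (Matrix.mulVecLin (1 - BB (B 0) (B 1)))).2 fun x hx => ?_
  have hfix (p : Fin 2 × Fin η) : x p = ∑ q, B p.1 p.2 q.2 * x q := by
    simpa [Matrix.sub_mulVec, sub_eq_zero, Matrix.mulVec, dotProduct, BB_apply] using congrFun hx p
  suffices ∀ i ν, x (ν, i) = 0 from funext fun p => this p.2 p.1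
  intro i
  induction i using WellFoundedLT.induction with
  | ind i ih =>
    refine fun ν => (hfix _).trans (Finset.sum_eq_zero fun q _ => ?_)
    rcases lt_or_ge q.2 i with h | h
    · rw [ih q.2 h q.1, mul_zero]
    · rw [hB ν i q.2 h, zero_mul]

variable (B)

theorem posDef_noiseCov (hN : 0 < N) (hKW : KW.PosSemidef) :
    (noiseCov N KW (B 0) (B 1)).PosDef := by
  refine (Matrix.PosDef.one.smul hN).add_posSemidef ?_
  have h := hKW.kronecker (Matrix.PosSemidef.one : (1 : Matrix (Fin η) (Fin η) ℝ).PosSemidef)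
  simpa using h.mul_mul_conjTranspose_same (Bb (B 0) (B 1))

theorem posDef_mul_noiseCov_mul {m : Type*} [Fintype m] [DecidableEq m] (hN : 0 < N)
    (hKW : KW.PosSemidef) {C : Matrix m (Fin η) ℝ} (hC : IsUnit (C * Cᵀ)) :
    (C * noiseCov N KW (B 0) (B 1) * Cᵀ).PosDef := by
  have hinj : Function.Injective C.vecMul := fun x y hxy =>
    Matrix.vecMul_injective_iff_isUnit.2 hC <| by
      simpa only [← Matrix.vecMul_vecMul] using congrArg (· ᵥ* Cᵀ) hxy
  simpa using (posDef_noiseCov B hN hKW).mul_mul_conjTranspose_same hinj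

end BlockNoise

section BlockEquations

variable {η : ℕ} {a : Fin 2 → Fin η → ℝ} {B : Fin 2 → Matrix (Fin η) (Fin η) ℝ} {x : Fin 2 → ℝ}
  {X : Fin 2 → Fin η → ℝ} {Y : Fin η → ℝ} {z : Fin η → ℝ × EuclideanSpace ℝ (Fin 2)}

theorem output_sub_mulVec_output
    (hX : ∀ ν i, X ν i = a ν i * x ν + ∑ j, B ν i j * (Y j + (z j).2 ν))
    (hY : ∀ i, Y i = X 0 i + X 1 i + (z i).1) :
    Y - (B 0 + B 1) *ᵥ Y = ∑ ν, x ν • a ν + residualNoise B z := by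
  ext i
  simp only [Pi.sub_apply, hY i, hX, residualNoise, linearNoise, Matrix.one_mulVec, Matrix.mulVec,
    dotProduct, Bb_apply, Matrix.add_apply, Pi.add_apply, Pi.smul_apply, smul_eq_mul,
    Fintype.sum_prod_type, Fin.sum_univ_two, mul_add, add_mul, Finset.sum_add_distrib]
  ring

theorem one_sub_BB_mulVec_input
    (hX : ∀ ν i, X ν i = a ν i * x ν + ∑ j, B ν i j * (Y j + (z j).2 ν))
    (hY : ∀ i, Y i = X 0 i + X 1 i + (z i).1) :
    (1 - BB (B 0) (B 1)) *ᵥ (fun p => X p.1 p.2) =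
      Ad (a 0) (a 1) *ᵥ x + linearNoise (Bt (B 0) (B 1)) (Bd (B 0) (B 1)) z := by
  ext ⟨ν, i⟩
  have hBd : (Bd (B 0) (B 1) *ᵥ fun q => (z q.2).2 q.1) (ν, i) = ∑ j, B ν i j * (z j).2 ν := by
    simp only [Matrix.mulVec, dotProduct, Bd_apply, Fintype.sum_prod_type_right, ite_mul, zero_mul,
      Finset.sum_ite_eq, Finset.mem_univ, if_true]
  simp only [Matrix.sub_mulVec, Matrix.one_mulVec, Pi.sub_apply, Pi.add_apply, linearNoise, hBd]
  simp only [hX ν i, hY, Matrix.mulVec, dotProduct, BB_apply, Ad_apply, Bt_apply,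
    Fintype.sum_prod_type, Fin.sum_univ_two (M := ℝ), ite_mul, zero_mul, mul_add,
    Finset.sum_add_distrib]
  fin_cases ν <;> simp <;> ring

theorem input_eq_inputSignal_add_inputNoise (hB : ∀ ν, StrictlyLower (B ν))
    (hX : ∀ ν i, X ν i = a ν i * x ν + ∑ j, B ν i j * (Y j + (z j).2 ν))
    (hY : ∀ i, Y i = X 0 i + X 1 i + (z i).1) (ν : Fin 2) (i : Fin η) :
    X ν i = inputSignal a B x (ν, i) + inputNoise B z (ν, i) := by
  have hdet := (Matrix.isUnit_iff_isUnit_det _).1 (isUnit_one_sub_BB hB)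
  have hinv := congrArg ((1 - BB (B 0) (B 1))⁻¹ *ᵥ ·) (one_sub_BB_mulVec_input hX hY)
  simp only [Matrix.mulVec_add, Matrix.mulVec_mulVec, Matrix.nonsing_inv_mul _ hdet,
    Matrix.one_mulVec] at hinv
  exact congrFun hinv (ν, i)

end BlockEquations

section LinearCode

variable {n η k : ℕ}

/-- The time of the `i`-th channel use in the `b`-th block of length `η`. -/
def blockTime (hk : k * η ≤ n) (p : Fin k × Fin η) : Fin n :=
  (finProdFinEquiv p).castLE hk

theorem blockTime_injective (hk : k * η ≤ n) : Function.Injective (blockTime hk) :=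
  (Fin.castLE_injective hk).comp finProdFinEquiv.injective

/-- Removal of the fed-back outputs from the outputs `y` in the blocks, see
`output_sub_mulVec_output`. -/
def stripFeedback (hk : k * η ≤ n) (B : Fin 2 → Matrix (Fin η) (Fin η) ℝ) (y : Fin n → ℝ)
    (b : Fin k) : Fin η → ℝ :=
  (fun i => y (blockTime hk (b, i))) - (B 0 + B 1) *ᵥ fun i => y (blockTime hk (b, i))

theorem measurable_mulVec_stripFeedback {m : Type*} (hk : k * η ≤ n)
    (B : Fin 2 → Matrix (Fin η) (Fin η) ℝ) (C : Matrix m (Fin η) ℝ) :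
    Measurable fun (y : Fin n → ℝ) b => C *ᵥ stripFeedback hk B y b := by
  unfold stripFeedback Matrix.mulVec dotProduct
  fun_prop

theorem measurePreserving_block {N : ℝ} {KW : Matrix (Fin 2) (Fin 2) ℝ} (hk : k * η ≤ n)
    (b : Fin k) :
    MeasurePreserving (fun (z : Fin n → ℝ × EuclideanSpace ℝ (Fin 2)) i => z (blockTime hk (b, i)))
      (Measure.pi fun _ => noiseLaw N KW) (Measure.pi fun _ => noiseLaw N KW) :=
  (measurePreserving_eval (fun _ => Measure.pi fun _ => noiseLaw N KW) b).comp
    (measurePreserving_pi_curry_of_injective _ (blockTime_injective hk))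

variable [NeZero η]

theorem mem_range_blockTime (hk : k * η ≤ n) {t : Fin n} (ht : (t : ℕ) / η < k) :
    t ∈ Set.range (blockTime hk) :=
  ⟨(⟨t / η, ht⟩, Fin.ofNat η t), Fin.ext (Nat.mod_add_div t η)⟩

/-- The feedback code that in each of the first `k` blocks of length `η` uses the linear feedback
scheme with parameters `a ν` and `B ν`, with the code symbols `x ν m` of message `m` for the
blocks; the inputs after the last block are `0`. -/
abbrev linearCode (n : ℕ) {M : Fin 2 → ℕ} [∀ ν, NeZero (M ν)] (a : Fin 2 → Fin η → ℝ)
    (B : Fin 2 → Matrix (Fin η) (Fin η) ℝ) (x : (ν : Fin 2) → Fin (M ν) → Fin k → ℝ)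
    {dec : (Fin n → ℝ) → (ν : Fin 2) → Fin (M ν)} (hdec : Measurable dec) : FeedbackCode n where
  M := M
  M_pos ν := Nat.pos_of_neZero (M ν)
  enc ν t m v :=
    if h : (t : ℕ) / η < k then
      a ν (Fin.ofNat η t) * x ν m ⟨t / η, h⟩ +
        ∑ j : Fin η, if hj : j + η * (t / η) < (t : ℕ) then
          B ν (Fin.ofNat η t) j * v ⟨j + η * (t / η), hj⟩ else 0
    else 0
  measurable_enc ν t m := by
    split_ifs with h
    · refine measurable_const.add (Finset.measurable_sum _ fun j _ => ?_)
      split_ifs with hj <;> fun_prop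
    · exact measurable_const
  dec := dec
  measurable_dec := hdec

variable {M : Fin 2 → ℕ} [∀ ν, NeZero (M ν)] {a : Fin 2 → Fin η → ℝ}
  {B : Fin 2 → Matrix (Fin η) (Fin η) ℝ} (x : (ν : Fin 2) → Fin (M ν) → Fin k → ℝ)
  {dec : (Fin n → ℝ) → (ν : Fin 2) → Fin (M ν)} (hdec : Measurable dec)

theorem input_linearCode_blockTime (hB : ∀ ν, StrictlyLower (B ν)) (hk : k * η ≤ n)
    (ω : (linearCode n a B x hdec).Sample) (b : Fin k) (ν : Fin 2) (i : Fin η) :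
    (linearCode n a B x hdec).input ω ν (blockTime hk (b, i)) =
      a ν i * x ν (ω.1 ν) b + ∑ j, B ν i j * ((linearCode n a B x hdec).output ω
        (blockTime hk (b, j)) + (ω.2 (blockTime hk (b, j))).2 ν) := by
  have hdiv : (i + η * b : ℕ) / η = b := by
    rw [Nat.add_mul_div_left _ _ i.pos, Nat.div_eq_of_lt i.2, zero_add]
  have hmod : Fin.ofNat η (i + η * b) = i := Fin.ext <| by
    simp [Nat.mod_eq_of_lt i.2]
  have hinput : (linearCode n a B x hdec).input ω ν (blockTime hk (b, i)) =
      if h : (i + η * b : ℕ) / η < k then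
        a ν (Fin.ofNat η (i + η * b)) * x ν (ω.1 ν) ⟨(i + η * b : ℕ) / η, h⟩ +
          ∑ j : Fin η, if hj : j + η * ((i + η * b) / η) < (i + η * b : ℕ) then
            B ν (Fin.ofNat η (i + η * b)) j * (linearCode n a B x hdec).feedback ω ν
              ⟨j + η * ((i + η * b) / η), hj.trans (blockTime hk (b, i)).2⟩ else 0
      else 0 := rfl
  simp only [hinput, hdiv, hmod, b.2, dif_pos, Fin.eta]
  congr! 2 with j
  by_cases hj : j < i
  · rw [dif_pos (by simpa using hj)]
    rfl
  · rw [dif_neg (by simpa using hj), hB ν i j (not_lt.1 hj), zero_mul]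

theorem input_linearCode_eq_zero (hk : k * η ≤ n) (ω : (linearCode n a B x hdec).Sample)
    (ν : Fin 2) {t : Fin n} (ht : t ∉ Set.range (blockTime hk)) :
    (linearCode n a B x hdec).input ω ν t = 0 :=
  dif_neg fun h => ht (mem_range_blockTime hk h)

theorem input_linearCode (hB : ∀ ν, StrictlyLower (B ν)) (hk : k * η ≤ n)
    (ω : (linearCode n a B x hdec).Sample) (ν : Fin 2) (b : Fin k) (i : Fin η) :
    (linearCode n a B x hdec).input ω ν (blockTime hk (b, i)) =
      inputSignal a B (fun μ => x μ (ω.1 μ) b) (ν, i) +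
        inputNoise B (fun j => ω.2 (blockTime hk (b, j))) (ν, i) :=
  input_eq_inputSignal_add_inputNoise hB (input_linearCode_blockTime x hdec hB hk ω b)
    (fun _ => FeedbackCode.output_eq _ ω _) ν i

theorem stripFeedback_output_linearCode (hB : ∀ ν, StrictlyLower (B ν)) (hk : k * η ≤ n)
    (ω : (linearCode n a B x hdec).Sample) (b : Fin k) :
    stripFeedback hk B ((linearCode n a B x hdec).output ω) b =
      ∑ ν, x ν (ω.1 ν) b • a ν + residualNoise B fun i => ω.2 (blockTime hk (b, i)) :=
  output_sub_mulVec_output (input_linearCode_blockTime x hdec hB hk ω b)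
    fun _ => FeedbackCode.output_eq _ ω _

end LinearCode

section LinearCodeAnalysis

/-- The law of the messages: independent and uniform. -/
noncomputable abbrev messageLaw (M : Fin 2 → ℕ) : Measure ((ν : Fin 2) → Fin (M ν)) :=
  Measure.pi fun ν => uniformOn (Set.univ : Set (Fin (M ν)))

instance isProbabilityMeasure_messageLaw (M : Fin 2 → ℕ) [∀ ν, NeZero (M ν)] :
    IsProbabilityMeasure (messageLaw M) :=
  have (ν : Fin 2) : IsProbabilityMeasure (uniformOn (Set.univ : Set (Fin (M ν)))) :=
    isProbabilityMeasure_uniformOn Set.finite_univ Set.univ_nonempty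
  inferInstance

/-- The memoryless channel that the linear feedback scheme creates from a block: its inputs are the
code symbols and its output is the image under `C` of the outputs stripped of the feedback. -/
def vectorChannel {η : ℕ} {m : Type*} (a : Fin 2 → Fin η → ℝ)
    (B : Fin 2 → Matrix (Fin η) (Fin η) ℝ) (C : Matrix m (Fin η) ℝ) (x : Fin 2 → ℝ)
    (z : Fin η → ℝ × EuclideanSpace ℝ (Fin 2)) : m → ℝ :=
  C *ᵥ (∑ ν, x ν • a ν + residualNoise B z)

theorem measurable_vectorChannel {η : ℕ} {m : Type*} (a : Fin 2 → Fin η → ℝ)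
    (B : Fin 2 → Matrix (Fin η) (Fin η) ℝ) (C : Matrix m (Fin η) ℝ) :
    Measurable (Function.uncurry (vectorChannel a B C)) := by
  have := measurable_residualNoise B
  unfold vectorChannel Matrix.mulVec dotProduct
  fun_prop

variable {n η k : ℕ} [NeZero η] {M : Fin 2 → ℕ} [∀ ν, NeZero (M ν)] {a : Fin 2 → Fin η → ℝ}
  {B : Fin 2 → Matrix (Fin η) (Fin η) ℝ} (x : (ν : Fin 2) → Fin (M ν) → Fin k → ℝ)
  {N : ℝ} {KW : Matrix (Fin 2) (Fin 2) ℝ}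

section Power

variable {dec : (Fin n → ℝ) → (ν : Fin 2) → Fin (M ν)} (hdec : Measurable dec)

theorem memLp_input_linearCode_blockTime (hN : 0 ≤ N) (hKW : KW.PosSemidef)
    (hB : ∀ ν, StrictlyLower (B ν)) (hk : k * η ≤ n) (ν : Fin 2) (b : Fin k) (i : Fin η) :
    MemLp (fun ω => (linearCode n a B x hdec).input ω ν (blockTime hk (b, i))) 2
      ((linearCode n a B x hdec).law N KW) := by
  simp only [input_linearCode x hdec hB hk]
  exact ((hasSecondMoments_inputNoise B hN hKW).comp_measurePreserving
    (measurePreserving_block hk b)).memLp_prod_add (π := messageLaw M)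
      (d := fun m => inputSignal a B (fun μ => x μ (m μ) b) (ν, i)) .of_discrete (ν, i)

theorem sum_integral_input_linearCode_sq (hN : 0 ≤ N) (hKW : KW.PosSemidef)
    (hB : ∀ ν, StrictlyLower (B ν)) (hk : k * η ≤ n) (ν : Fin 2) :
    ∑ t, ∫ ω, (linearCode n a B x hdec).input ω ν t ^ 2 ∂((linearCode n a B x hdec).law N KW) =
      ∫ m, ∑ b, signalEnergy a B ν (fun μ => x μ (m μ) b) ∂(messageLaw M) +
        k * noisePower N KW B ν := by
  have hblock (b : Fin k) : ∑ i, ∫ ω, (linearCode n a B x hdec).input ω ν (blockTime hk (b, i)) ^ 2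
      ∂((linearCode n a B x hdec).law N KW) =
        ∫ m, signalEnergy a B ν (fun μ => x μ (m μ) b) ∂(messageLaw M) + noisePower N KW B ν := by
    have hU := (hasSecondMoments_inputNoise B hN hKW).comp_measurePreserving
      (measurePreserving_block hk b)
    simp only [input_linearCode x hdec hB hk]
    unfold signalEnergy
    rw [integral_finsetSum _ fun _ _ => Integrable.of_finite, noisePower, Matrix.trace,
      ← Finset.sum_add_distrib]
    exact Finset.sum_congr rfl fun i _ =>
      hU.integral_prod_add_sq (π := messageLaw M)
        (d := fun m => inputSignal a B (fun μ => x μ (m μ) b) (ν, i)) .of_discrete (ν, i)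
  calc _ = ∑ p, ∫ ω, (linearCode n a B x hdec).input ω ν (blockTime hk p) ^ 2
        ∂((linearCode n a B x hdec).law N KW) :=
        (Fintype.sum_of_injective (blockTime hk) (blockTime_injective hk) _ _
          (fun t ht => by simp [input_linearCode_eq_zero x hdec hk _ ν ht]) fun _ => rfl).symm
    _ = _ := by
        rw [Fintype.sum_prod_type, Finset.sum_congr rfl fun b _ => hblock b,
          Finset.sum_add_distrib, integral_finsetSum _ fun _ _ => Integrable.of_finite]
        simp

theorem satisfiesPower_linearCode (hN : 0 ≤ N) (hKW : KW.PosSemidef)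
    (hB : ∀ ν, StrictlyLower (B ν)) (hk : k * η ≤ n) (ν : Fin 2) {P : ℝ}
    (hP : 1 / (n : ℝ) * (∫ m, ∑ b, signalEnergy a B ν (fun μ => x μ (m μ) b) ∂(messageLaw M) +
      k * noisePower N KW B ν) ≤ P) :
    (linearCode n a B x hdec).SatisfiesPower N KW ν P := by
  refine ⟨fun t => ?_, (sum_integral_input_linearCode_sq x hdec hN hKW hB hk ν).symm ▸ hP⟩
  by_cases ht : t ∈ Set.range (blockTime hk)
  · obtain ⟨⟨b, i⟩, rfl⟩ := ht
    exact (memLp_input_linearCode_blockTime x hdec hN hKW hB hk ν b i).integrable_sq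
  · simp [input_linearCode_eq_zero x hdec hk _ ν ht]

end Power

theorem errorProb_linearCode {m : Type*} {C : Matrix m (Fin η) ℝ}
    {dec : (Fin k → m → ℝ) → (ν : Fin 2) → Fin (M ν)} (hdec : Measurable dec)
    (hB : ∀ ν, StrictlyLower (B ν)) (hk : k * η ≤ n) :
    (linearCode n a B x (dec := fun y => dec fun b => C *ᵥ stripFeedback hk B y b)
      (hdec.comp (measurable_mulVec_stripFeedback hk B C))).errorProb N KW =
    (∫⁻ m, (Measure.pi fun _ => Measure.pi fun _ => noiseLaw N KW)
      {z | dec (blockChannel (vectorChannel a B C) (codeword x m) z) ≠ m}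
        ∂(messageLaw M)).toReal := by
  have hset : MeasurableSet {q : ((ν : Fin 2) → Fin (M ν)) × (Fin k → Fin η → _) |
      dec (blockChannel (vectorChannel a B C) (codeword x q.1) q.2) ≠ q.1} := by
    have hx : Measurable (codeword x) := .of_discrete
    refine (measurableSet_eq_fun (hdec.comp ((measurable_blockChannel
      (measurable_vectorChannel a B C)).comp (hx.prodMap measurable_id))) measurable_fst).compl
  have hmp := (MeasurePreserving.id (messageLaw M)).prod
    (measurePreserving_pi_curry_of_injective (noiseLaw N KW) (blockTime_injective hk))
  refine Eq.trans ?_ (congrArg ENNReal.toReal (Measure.prod_apply hset))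
  rw [← hmp.measure_preimage hset.nullMeasurableSet]
  refine congrArg (fun S => ENNReal.toReal
    (((messageLaw M).prod (Measure.pi fun _ : Fin n => noiseLaw N KW)) S)) ?_
  ext ω
  have hstrip := funext fun b => congrArg (C *ᵥ ·) (stripFeedback_output_linearCode x
    (hdec.comp (measurable_mulVec_stripFeedback hk B C)) hB hk ω b)
  exact Iff.of_eq (congrArg (fun y => dec y ≠ ω.1) hstrip)

end LinearCodeAnalysis

section AveragePower

theorem integral_le_mul_add_toReal {A : Type*} [Finite A] [MeasurableSpace A]
    [DiscreteMeasurableSpace A] {π : Measure A} [IsProbabilityMeasure π] {F : A → ℝ} {k c : ℝ}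
    (hk : 0 < k) {ε : ℝ≥0∞} (hε : ε ≠ ∞) (h : ∫⁻ m, ‖k⁻¹ * F m - c‖ₑ ∂π ≤ ε) :
    ∫ m, F m ∂π ≤ k * (c + ε.toReal) := by
  have hnorm : ∫ m, ‖k⁻¹ * F m - c‖ ∂π ≤ ε.toReal := by
    rw [integral_norm_eq_lintegral_enorm Measurable.of_discrete.aestronglyMeasurable]
    exact ENNReal.toReal_mono hε h
  have hmean : k⁻¹ * ∫ m, F m ∂π - c ≤ ε.toReal := by
    refine le_trans ?_ ((integral_mono .of_finite .of_finite fun m => Real.le_norm_self _).trans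
      hnorm)
    rw [integral_sub .of_finite .of_finite, integral_const_mul]
    simp
  rw [← inv_mul_le_iff₀ hk]
  linarith

theorem average_power_le {n k η : ℕ} {A : Type*} [Finite A] [MeasurableSpace A]
    [DiscreteMeasurableSpace A] {π : Measure A} [IsProbabilityMeasure π]
    {a : Fin 2 → Fin η → ℝ} {B : Fin 2 → Matrix (Fin η) (Fin η) ℝ} {N : ℝ}
    {KW : Matrix (Fin 2) (Fin 2) ℝ} {ν : Fin 2} {q : A → Fin k → Fin 2 → ℝ} (hk : 0 < k)
    (hkn : k * η ≤ n) {ε : ℝ≥0∞} (hε : ε ≠ ∞)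
    (h : ∫⁻ m, ‖(k : ℝ)⁻¹ * ∑ b, signalEnergy a B ν (q m b) - signalPower a B ν‖ₑ ∂π ≤ ε)
    {P : ℝ} (hP : 0 ≤ P) (htr : signalPower a B ν + noisePower N KW B ν ≤ η * P)
    (hslack : signalPower a B ν ≠ 0 →
      signalPower a B ν + ε.toReal + noisePower N KW B ν ≤ η * P) :
    1 / (n : ℝ) * (∫ m, ∑ b, signalEnergy a B ν (q m b) ∂π + k * noisePower N KW B ν) ≤ P := by
  have hkn' : (k : ℝ) * η ≤ n := by exact_mod_cast hkn
  have hblocks : ∫ m, ∑ b, signalEnergy a B ν (q m b) ∂π + k * noisePower N KW B ν ≤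
      k * (η * P) := by
    by_cases h0 : signalPower a B ν = 0
    · simp only [signalEnergy_eq_zero h0, Finset.sum_const_zero, integral_zero, zero_add]
      rw [h0, zero_add] at htr
      gcongr
    · calc _ ≤ k * (signalPower a B ν + ε.toReal) + k * noisePower N KW B ν := by
            gcongr
            exact integral_le_mul_add_toReal (by exact_mod_cast hk) hε h
        _ ≤ k * (η * P) := by
            rw [← mul_add]
            gcongr
            exact hslack h0
  rw [one_div]
  refine inv_mul_le_of_le_mul₀ n.cast_nonneg hP ?_
  calc _ ≤ k * (η * P) := hblocks
    _ = k * η * P := by ring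
    _ ≤ n * P := by gcongr

end AveragePower

section MessageCounts

/-- The number of messages of a code of blocklength `n` whose rate is to be at least `r`. -/
noncomputable abbrev messageCount (n : ℕ) (r : ℝ) : ℕ :=
  ⌊Real.exp (n * r)⌋₊ + 1

theorem le_one_div_mul_log_messageCount {n : ℕ} (hn : 0 < n) (r : ℝ) :
    r ≤ 1 / (n : ℝ) * Real.log (messageCount n r) := by
  have hn' : (0 : ℝ) < n := by exact_mod_cast hn
  rw [one_div, le_inv_mul_iff₀ hn', Real.le_log_iff_exp_le (by positivity)]
  exact_mod_cast (Nat.lt_floor_add_one _).le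

theorem prod_messageCount_sub_one_le {ι : Type*} (n : ℕ) (T : Finset ι) (r : ι → ℝ) :
    ((∏ ν ∈ T, (messageCount n (r ν) - 1) : ℕ) : ℝ≥0∞) ≤
      ENNReal.ofReal (Real.exp (n * ∑ ν ∈ T, r ν)) := by
  rw [← ENNReal.ofReal_natCast, Finset.mul_sum, Real.exp_sum]
  push_cast [Nat.add_sub_cancel]
  exact ENNReal.ofReal_le_ofReal
    (Finset.prod_le_prod (fun _ _ => by positivity) fun _ _ => Nat.floor_le (Real.exp_nonneg _))

theorem tendsto_mul_sub_div_mul_atBot {η : ℕ} (hη : 0 < η) {r γ : ℝ} (h : η * r < γ) :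
    Tendsto (fun n : ℕ => n * r - (n / η : ℕ) * γ) atTop atBot := by
  have hk : Tendsto (fun n : ℕ => ((n / η : ℕ) : ℝ)) atTop atTop :=
    tendsto_natCast_atTop_atTop.comp (Nat.tendsto_div_const_atTop hη.ne')
  have hlim : Tendsto (fun n : ℕ => -(((n / η : ℕ) : ℝ) * (γ - η * r)) + η * |r|) atTop atBot :=
    tendsto_atBot_add_const_right _ _
      (tendsto_neg_atTop_atBot.comp (hk.atTop_mul_const (sub_pos.2 h)))
  refine tendsto_atBot_mono (fun n => ?_) hlim
  have hdiv : (n : ℝ) = (n / η : ℕ) * η + (n % η : ℕ) := by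
    exact_mod_cast (Nat.div_add_mod' n η).symm
  have hmod : ((n % η : ℕ) : ℝ) * r ≤ η * |r| := by
    have hlt : ((n % η : ℕ) : ℝ) ≤ η := by exact_mod_cast (Nat.mod_lt n hη).le
    calc ((n % η : ℕ) : ℝ) * r ≤ (n % η : ℕ) * |r| := by gcongr; exact le_abs_self r
      _ ≤ η * |r| := by gcongr
  linear_combination r * hdiv + hmod

theorem tendsto_prod_messageCount_mul_exp {ι : Type*} {η : ℕ} (hη : 0 < η) {T : Finset ι}
    {r : ι → ℝ} {γ : ℝ} (h : η * ∑ ν ∈ T, r ν < γ) :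
    Tendsto (fun n : ℕ => ((∏ ν ∈ T, (messageCount n (r ν) - 1) : ℕ) : ℝ≥0∞) *
      ENNReal.ofReal (Real.exp (-((n / η : ℕ) * γ)))) atTop (𝓝 0) := by
  have hlim := ENNReal.tendsto_ofReal
    (Real.tendsto_exp_atBot.comp (tendsto_mul_sub_div_mul_atBot hη h))
  rw [ENNReal.ofReal_zero] at hlim
  refine tendsto_of_tendsto_of_tendsto_of_le_of_le tendsto_const_nhds hlim
    (fun _ => zero_le) fun n => ?_
  rw [Function.comp_apply, sub_eq_add_neg, Real.exp_add, ENNReal.ofReal_mul (Real.exp_nonneg _)]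
  gcongr
  exact prod_messageCount_sub_one_le n T r

end MessageCounts

section Achievability

variable {η : ℕ} {a : Fin 2 → Fin η → ℝ} {B : Fin 2 → Matrix (Fin η) (Fin η) ℝ} {N : ℝ}
  {KW : Matrix (Fin 2) (Fin 2) ℝ} {P : Fin 2 → ℝ} {m : Type} {C : Matrix m (Fin η) ℝ}

theorem vectorChannel_eq_sum_smul_mulVec (x : Fin 2 → ℝ)
    (z : Fin η → ℝ × EuclideanSpace ℝ (Fin 2)) :
    vectorChannel a B C x z = ∑ ν, x ν • C *ᵥ a ν + C *ᵥ residualNoise B z := by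
  simp only [vectorChannel, Matrix.mulVec_add, Matrix.mulVec_sum, Matrix.mulVec_smul]

theorem mul_sum_vecMulVec_add_mul_transpose (S : Matrix (Fin η) (Fin η) ℝ) (T : Finset (Fin 2)) :
    C * (∑ ν ∈ T, Matrix.vecMulVec (a ν) (a ν) + S) * Cᵀ =
      C * S * Cᵀ + ∑ ν ∈ T, Matrix.vecMulVec (C *ᵥ a ν) (C *ᵥ a ν) := by
  simp only [Matrix.mul_add, Matrix.add_mul, Matrix.mul_sum, Matrix.sum_mul,
    Matrix.mul_vecMulVec, Matrix.vecMulVec_mul, Matrix.vecMul_transpose, add_comm]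

variable [Fintype m] [DecidableEq m]

theorem integral_gaussianDensity_vectorChannel (hη : η ≠ 0) (hN : 0 < N) (hKW : KW.PosSemidef)
    (hC : IsUnit (C * Cᵀ)) (T : Finset (Fin 2)) :
    ∫ q, gaussianDensity (fun ν => C *ᵥ a ν) (C * noiseCov N KW (B 0) (B 1) * Cᵀ) T q.1
        (vectorChannel a B C q.1 q.2) ∂((Measure.pi fun _ => gaussianReal 0 1).prod
          (Measure.pi fun _ => noiseLaw N KW)) =
      η * rateBound N KW (B 0) (B 1) C (∑ ν ∈ T, Matrix.vecMulVec (a ν) (a ν)) := by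
  simp only [vectorChannel_eq_sum_smul_mulVec]
  rw [((hasSecondMoments_residualNoise B hN.le hKW).mulVec C).integral_gaussianDensity
    (posDef_mul_noiseCov_mul B hN hKW hC), rateBound, mul_sum_vecMulVec_add_mul_transpose]
  field_simp

theorem exists_codes_vectorChannel (hη : 0 < η) (hN : 0 < N) (hKW : KW.PosSemidef)
    (hC : IsUnit (C * Cᵀ)) {r : Fin 2 → ℝ}
    (hr : ∀ T : Finset (Fin 2), T.Nonempty → ∑ ν ∈ T, r ν <
      rateBound N KW (B 0) (B 1) C (∑ ν ∈ T, Matrix.vecMulVec (a ν) (a ν))) :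
    ∃ (x : ∀ n ν, Fin (messageCount n (r ν)) → Fin (n / η) → ℝ)
      (dec : ∀ n, (Fin (n / η) → m → ℝ) → ∀ ν, Fin (messageCount n (r ν))),
      (∀ n, Measurable (dec n)) ∧
      Tendsto (fun n => ∫⁻ w, ((Measure.pi fun _ => Measure.pi fun _ => noiseLaw N KW)
          {z | dec n (blockChannel (vectorChannel a B C) (codeword (x n) w) z) ≠ w} +
        ∑ ν, ‖((n / η : ℕ) : ℝ)⁻¹ * ∑ b, signalEnergy a B ν (fun μ => x n μ (w μ) b) -
          signalPower a B ν‖ₑ) ∂(messageLaw fun ν => messageCount n (r ν))) atTop (𝓝 0) := by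
  have hη' : (0 : ℝ) < η := by exact_mod_cast hη
  have hU := (hasSecondMoments_residualNoise B hN.le hKW).mulVec C
  choose! γ hrγ hγ using fun T hT => exists_between (mul_lt_mul_of_pos_left (hr T hT) hη')
  have hint (T : Finset (Fin 2)) := hU.integrable_gaussianDensity (fun ν => C *ᵥ a ν) T
  simp only [← vectorChannel_eq_sum_smul_mulVec] at hint
  simpa only [integral_signalEnergy] using exists_vanishing_codes
    (measurable_vectorChannel a B C)
    (isInformationDensity_gaussianDensity (posDef_mul_noiseCov_mul B hN hKW hC) fun ν => C *ᵥ a ν)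
    (fun T _ => hint T)
    (fun T hT => (hγ T hT).trans_eq
      (integral_gaussianDensity_vectorChannel hη.ne' hN hKW hC T).symm)
    (measurable_signalEnergy a B) (integrable_signalEnergy a B)
    (Nat.tendsto_div_const_atTop hη.ne')
    (fun T hT => tendsto_prod_messageCount_mul_exp hη (hrγ T hT))
    fun n => messageLaw fun ν => messageCount n (r ν)

theorem exists_feedbackCodes (hη : 0 < η) (hN : 0 < N) (hKW : KW.PosSemidef)
    (hB : ∀ ν, StrictlyLower (B ν)) (hC : IsUnit (C * Cᵀ)) (hP : ∀ ν, 0 ≤ P ν)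
    (htr : ∀ ν, signalPower a B ν + noisePower N KW B ν ≤ η * P ν)
    (hslack : ∀ ν, signalPower a B ν ≠ 0 → signalPower a B ν + noisePower N KW B ν < η * P ν)
    {r : Fin 2 → ℝ}
    (hr : ∀ T : Finset (Fin 2), T.Nonempty → ∑ ν ∈ T, r ν <
      rateBound N KW (B 0) (B 1) C (∑ ν ∈ T, Matrix.vecMulVec (a ν) (a ν))) :
    ∃ c : (n : ℕ) → FeedbackCode n,
      (∀ᶠ n in atTop, ∀ ν, (c n).SatisfiesPower N KW ν (P ν) ∧ r ν ≤ (c n).rate ν) ∧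
      Tendsto (fun n => (c n).errorProb N KW) atTop (𝓝 0) := by
  have : NeZero η := ⟨hη.ne'⟩
  obtain ⟨x, dec, hdec, hlim⟩ := exists_codes_vectorChannel hη hN hKW hC hr
  set ε : ℕ → ℝ≥0∞ := fun n => ∫⁻ w, _ ∂_
  have hkn (n : ℕ) : n / η * η ≤ n := Nat.div_mul_le_self n η
  have hfin : ∀ᶠ n in atTop, ε n ≠ ∞ :=
    (hlim.eventually_lt_const ENNReal.zero_lt_top).mono fun n hn => hn.ne
  have hlim' : Tendsto (fun n => (ε n).toReal) atTop (𝓝 0) :=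
    (ENNReal.tendsto_toReal ENNReal.zero_ne_top).comp hlim
  have hsmall : ∀ᶠ n in atTop, ∀ ν, signalPower a B ν ≠ 0 →
      signalPower a B ν + (ε n).toReal + noisePower N KW B ν ≤ η * P ν := by
    refine eventually_all.2 fun ν => eventually_imp_distrib_left.2 fun h0 => ?_
    filter_upwards [hlim'.eventually_le_const (sub_pos.2 (hslack ν h0))] with n hn
    linarith
  refine ⟨fun n => linearCode n a B (x n)
    ((hdec n).comp (measurable_mulVec_stripFeedback (hkn n) B C)), ?_, ?_⟩
  · filter_upwards [hfin, hsmall, eventually_ge_atTop η] with n hn hs hηn ν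
    refine ⟨satisfiesPower_linearCode (x n) _ hN.le hKW hB (hkn n) ν (average_power_le
      (Nat.div_pos hηn hη) (hkn n) hn (lintegral_mono fun w => ?_) (hP ν) (htr ν) (hs ν)),
      le_one_div_mul_log_messageCount (hη.trans_le hηn) _⟩
    exact (Finset.single_le_sum_of_canonicallyOrdered
      (f := fun ν => ‖((n / η : ℕ) : ℝ)⁻¹ * ∑ b, signalEnergy a B ν (fun μ => x n μ (w μ) b) -
        signalPower a B ν‖ₑ) (Finset.mem_univ ν)).trans le_add_self
  · refine squeeze_zero' (Eventually.of_forall fun n => measureReal_nonneg) ?_ hlim'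
    filter_upwards [hfin] with n hn
    exact (errorProb_linearCode (x n) (hdec n) hB (hkn n)).trans_le
      (ENNReal.toReal_mono hn (lintegral_mono fun w => le_self_add))

theorem eventually_lt_rateBound_smul (hN : 0 < N) (hKW : KW.PosSemidef) (hC : IsUnit (C * Cᵀ))
    {T : Finset (Fin 2)} {ρ : ℝ}
    (h : ρ < rateBound N KW (B 0) (B 1) C (∑ ν ∈ T, Matrix.vecMulVec (a ν) (a ν))) :
    ∀ᶠ s : ℝ in 𝓝 1, ρ < rateBound N KW (B 0) (B 1) C
      (∑ ν ∈ T, Matrix.vecMulVec ((s • a) ν) ((s • a) ν)) := by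
  have hS := posDef_mul_noiseCov_mul B hN hKW hC
  have hTS : (C * (∑ ν ∈ T, Matrix.vecMulVec (a ν) (a ν) + noiseCov N KW (B 0) (B 1)) *
      Cᵀ).PosDef := by
    rw [mul_sum_vecMulVec_add_mul_transpose]
    exact hS.add_posSemidef (Matrix.posSemidef_sum T fun ν _ => by
      simpa using Matrix.posSemidef_vecMulVec_self_star (C *ᵥ a ν))
  have hdet : ContinuousAt (fun s : ℝ => (C * (∑ ν ∈ T, Matrix.vecMulVec ((s • a) ν) ((s • a) ν) +
      noiseCov N KW (B 0) (B 1)) * Cᵀ).det / (C * noiseCov N KW (B 0) (B 1) * Cᵀ).det) 1 := by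
    refine Continuous.continuousAt ?_
    simp only [Pi.smul_apply, Matrix.smul_vecMulVec, Matrix.vecMulVec_smul]
    fun_prop
  refine (continuousAt_const.mul (hdet.log ?_)).eventually_const_lt ?_
  · simpa using (div_pos hTS.det_pos hS.det_pos).ne'
  · simpa [rateBound] using h

theorem Ab_mul_transpose : Ab (a 0) (a 1) * (Ab (a 0) (a 1))ᵀ =
    ∑ ν, Matrix.vecMulVec (a ν) (a ν) := by
  ext i j
  simp [Matrix.mul_apply, Ab_apply, Fin.sum_univ_two, Matrix.vecMulVec_apply]

theorem sum_sub_lt_rateBound {R : ℝ × ℝ} (hR : R ∈ logDetRegion N KW (a 0) (a 1) (B 0) (B 1) C)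
    {δ : ℝ} (hδ : 0 < δ) {T : Finset (Fin 2)} (hT : T.Nonempty) :
    ∑ ν ∈ T, ![R.1 - δ, R.2 - δ] ν <
      rateBound N KW (B 0) (B 1) C (∑ ν ∈ T, Matrix.vecMulVec (a ν) (a ν)) := by
  obtain ⟨-, -, h₁, h₂, h₁₂⟩ := hR
  rw [Ab_mul_transpose] at h₁₂
  have hcases : T = {0} ∨ T = {1} ∨ T = Finset.univ := by
    revert T
    decide
  rcases hcases with rfl | rfl | rfl
  · simpa using (sub_lt_self _ hδ).trans_le h₁
  · simpa using (sub_lt_self _ hδ).trans_le h₂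
  · rw [Fin.sum_univ_two]
    simp only [Matrix.cons_val_zero, Matrix.cons_val_one]
    linarith

theorem achievable_of_mem_logDetRegion (hη : 0 < η) (hN : 0 < N) (hKW : KW.PosSemidef)
    (hB : ∀ ν, StrictlyLower (B ν)) (hC : IsUnit (C * Cᵀ)) (hP : ∀ ν, 0 ≤ P ν)
    (htr : ∀ ν, signalPower a B ν + noisePower N KW B ν ≤ η * P ν) {R : ℝ × ℝ}
    (hR : R ∈ logDetRegion N KW (a 0) (a 1) (B 0) (B 1) C) :
    Achievable (P 0) (P 1) N KW R := by
  intro δ hδ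
  have hrate : ∀ᶠ s in 𝓝[<] (1 : ℝ), ∀ T : Finset (Fin 2), T.Nonempty →
      ∑ ν ∈ T, ![R.1 - δ / 2, R.2 - δ / 2] ν < rateBound N KW (B 0) (B 1) C
        (∑ ν ∈ T, Matrix.vecMulVec ((s • a) ν) ((s • a) ν)) :=
    eventually_all.2 fun T => eventually_imp_distrib_left.2 fun hT =>
      (eventually_lt_rateBound_smul hN hKW hC
        (sum_sub_lt_rateBound hR (half_pos hδ) hT)).filter_mono nhdsWithin_le_nhds
  have hpos : ∀ᶠ s in 𝓝[<] (1 : ℝ), 0 < s :=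
    (eventually_gt_nhds zero_lt_one).filter_mono nhdsWithin_le_nhds
  obtain ⟨s, hs, hs0, hs1⟩ := (hrate.and (hpos.and self_mem_nhdsWithin)).exists
  have hsq : s ^ 2 < 1 := pow_lt_one₀ hs0.le hs1 two_ne_zero
  obtain ⟨c, hc, herr⟩ := exists_feedbackCodes (a := s • a) hη hN hKW hB hC hP
    (fun ν => by
      rw [signalPower_smul]
      have := mul_le_of_le_one_left (signalPower_nonneg a B ν) hsq.le
      linarith [htr ν])
    (fun ν h0 => by
      rw [signalPower_smul] at h0 ⊢
      have := mul_lt_of_lt_one_left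
        ((signalPower_nonneg a B ν).lt_of_ne' (right_ne_zero_of_mul h0)) hsq
      linarith [htr ν]) hs
  refine ⟨c, hc.mono fun n hn => ⟨(hn 0).1, (hn 1).1, ?_, ?_⟩, herr⟩
  · exact (sub_lt_sub_left (half_lt_self hδ) _).trans_le (hn 0).2
  · exact (sub_lt_sub_left (half_lt_self hδ) _).trans_le (hn 1).2

theorem achievable_zero (hP : ∀ ν, 0 ≤ P ν) : Achievable (P 0) (P 1) N KW (0, 0) := by
  refine fun δ hδ => ⟨fun n => ⟨fun _ => 1, fun _ => one_pos, fun _ _ _ _ => 0,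
    fun _ _ _ => measurable_const, fun _ _ => 0, measurable_const⟩,
    Eventually.of_forall fun n => ?_, tendsto_const_nhds.congr fun n => Eq.symm ?_⟩
  · simp [FeedbackCode.SatisfiesPower, FeedbackCode.rate, FeedbackCode.input, hP, hδ]
  · have hcorrect (w : (ν : Fin 2) → Fin 1) : (fun _ => 0) = w := Subsingleton.elim _ w
    refine (congrArg _ (Set.eq_empty_of_forall_notMem fun ω h => ?_)).trans measureReal_empty
    exact h (hcorrect ω.1)

theorem isUnit_replicateRow_mul_transpose {v : Fin η → ℝ} (hv : v ≠ 0) :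
    IsUnit (Matrix.replicateRow Unit v * (Matrix.replicateRow Unit v)ᵀ) := by
  rw [Matrix.isUnit_iff_isUnit_det, isUnit_iff_ne_zero]
  simpa [Matrix.det_unique, Matrix.mul_apply, dotProduct] using
    (dotProduct_self_eq_zero (v := v)).not.2 hv

theorem mem_capacityNoisyFB_of_mem_paramRegion (hη : 0 < η) (hN : 0 < N) (hKW : KW.PosSemidef)
    (hB : ∀ ν, StrictlyLower (B ν)) (hP : ∀ ν, 0 ≤ P ν)
    (htr : ∀ ν, (diagBlock (inputCov N KW (a 0) (a 1) (B 0) (B 1)) ν).trace ≤ η * P ν)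
    {C : Matrix (Fin 2) (Fin η) ℝ} {R : ℝ × ℝ}
    (hR : R ∈ paramRegion N KW (a 0) (a 1) (B 0) (B 1) C) :
    R ∈ capacityNoisyFB (P 0) (P 1) N KW := by
  simp only [trace_diagBlock_inputCov] at htr
  unfold paramRegion at hR
  split_ifs at hR with hC h0
  · exact ⟨hR.1, hR.2.1, achievable_of_mem_logDetRegion hη hN hKW hB hC hP htr hR⟩
  · obtain ⟨i, hi, hR⟩ := hR
    exact ⟨hR.1, hR.2.1, achievable_of_mem_logDetRegion hη hN hKW hB
      (isUnit_replicateRow_mul_transpose hi) hP htr hR⟩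
  · obtain rfl : R = (0, 0) := hR
    exact ⟨le_rfl, le_rfl, achievable_zero hP⟩

theorem isClosed_capacityNoisyFB (P₁ P₂ N : ℝ) (KW : Matrix (Fin 2) (Fin 2) ℝ) :
    IsClosed (capacityNoisyFB P₁ P₂ N KW) := by
  refine isClosed_of_closure_subset fun R hR => ⟨?_, ?_, fun δ hδ => ?_⟩
  · exact closure_minimal (fun R hR => hR.1) (isClosed_le continuous_const continuous_fst) hR
  · exact closure_minimal (fun R hR => hR.2.1) (isClosed_le continuous_const continuous_snd) hR
  · obtain ⟨R', hR', hd⟩ := Metric.mem_closure_iff.1 hR (δ / 2) (half_pos hδ)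
    obtain ⟨c, hc, herr⟩ := hR'.2.2 (δ / 2) (half_pos hδ)
    rw [Prod.dist_eq, max_lt_iff, Real.dist_eq, Real.dist_eq] at hd
    have h₁ := (abs_lt.1 hd.1).2
    have h₂ := (abs_lt.1 hd.2).2
    exact ⟨c, hc.mono fun n ⟨hp₁, hp₂, hr⟩ => ⟨hp₁, hp₂, by linarith [hr.1], by linarith [hr.2]⟩,
      herr⟩

end Achievability

end NoisyFBMAC

theorem mainTheorem1 (P₁ P₂ N : ℝ) (hP₁ : 0 ≤ P₁) (hP₂ : 0 ≤ P₂) (hN : 0 < N)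
    (KW : Matrix (Fin 2) (Fin 2) ℝ) (hKW : KW.PosSemidef) :
    NoisyFBMAC.region P₁ P₂ N KW ⊆ NoisyFBMAC.capacityNoisyFB P₁ P₂ N KW := by
  refine closure_minimal ?_ (NoisyFBMAC.isClosed_capacityNoisyFB P₁ P₂ N KW)
  rintro R ⟨η, a₁, a₂, B₁, B₂, C, hη, hB₁, hB₂, htr, hR⟩
  exact NoisyFBMAC.mem_capacityNoisyFB_of_mem_paramRegion (P := ![P₁, P₂]) (a := ![a₁, a₂])
    (B := ![B₁, B₂]) hη hN hKW (Fin.forall_fin_two.2 ⟨hB₁, hB₂⟩) (Fin.forall_fin_two.2 ⟨hP₁, hP₂⟩)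
    (Fin.forall_fin_two.2 htr) hR
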